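/- Let $G$ be a finite simple graph with vertices $v_1,\dots,v_m$. A configuration on $G$ is a function $C:V(G)\to\mathbb{N}\cup\{0\}$, where $C(v)$ is the number of pebbles on $v$. A pebbling move removes two pebbles from a vertex that carries at least two pebbles and places one pebble on an adjacent vertex. $C$ is cover solvable on $G$ if some finite sequence of pebbling moves leads from $C$ to a configuration with at least one pebble on every vertex simultaneously. Encode a pair $(G,C)$ as a word over the alphabet $\{0,1,\#\}$ that lists, for each $i=1,\dots,m$, the number $C(v_i)$ in binary and the entries of the adjacency matrix of $G$ in row $i$ left of the diagonal, each of these two blocks being followed by $\#$. A language $L$ over a finite alphabet lies in NP if it has a polynomial-time verifier: a relation $R(x,y)$ between words $x$ and certificates $y$ (words over a finite alphabet) that a Turing machine decides in time polynomial in $|x|+|y|$, such that $R(x,y)$ implies $x\in L$, and such that every $x\in L$ has a certificate $y$ with $R(x,y)$ whose length is at most a fixed polynomial in $|x|$. Corollary 8. The cover solvability decision problem, which accepts a word if and only if it encodes a pair $(G,C)$ with $G$ a graph and $C$ a configuration that is cover solvable on $G$, is in NP. Moreover, vectors of move counts serve as the certificates: the following relation is a polynomial-time verifier for this problem. The word $x$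 encodes a pair $(G,C)$, and the word $y$ encodes (listing, for $i=1,\dots,m$ and $j=1,\dots,i-1$, the numbers $n_{ij}$ and $n_{ji}$ in binary, each followed by $\#$) integers $n_{ij}\ge 0$, $1\le i,j\le m$, with $n_{ij}=n_{ji}=0$ whenever $\{v_i,v_j\}\notin E(G)$ (in particular $n_{ii}=0$), such that for all $1\le k\le m$ $$C(v_k)+\sum_{l=1}^m n_{lk}-2\sum_{l=1}^m n_{kl}\ \ge\ 1 .$$ -/

import Mathlib

/-! ### Cover pebbling -/

/-- A pebbling move on `G`: two pebbles are removed from a vertex `u` carrying at least two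
pebbles, and one pebble is placed on a vertex `v` adjacent to `u`. -/
def PebblingMove {V : Type*} [DecidableEq V] (G : SimpleGraph V) (C D : V → ℕ) : Prop :=
  ∃ u v : V, G.Adj u v ∧ 2 ≤ C u ∧
    D = fun w => if w = u then C w - 2 else if w = v then C w + 1 else C w

/-- `C` is cover solvable on `G`: some finite sequence of pebbling moves leads from `C` to a
configuration with at least one pebble on every vertex simultaneously. -/
def CoverSolvable {V : Type*} [DecidableEq V] (G : SimpleGraph V) (C : V → ℕ) : Prop :=
  ∃ D : V → ℕ, Relation.ReflTransGen (PebblingMove G) C D ∧ ∀ v, 1 ≤ D v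

/-- `n i j` (the number of moves from `i` to `j`) is a vector of move counts for `(G, C)`:
it vanishes off the edges of `G`, and every vertex has a balance of at least one pebble. -/
def IsMoveCount {m : ℕ} (G : SimpleGraph (Fin m)) (C : Fin m → ℕ)
    (n : Fin m → Fin m → ℕ) : Prop :=
  (∀ i j, ¬ G.Adj i j → n i j = 0) ∧
  ∀ k, 1 ≤ (C k : ℤ) + ∑ l, (n l k : ℤ) - 2 * ∑ l, (n k l : ℤ)

/-! ### The class NP -/

/-- The pair of words `(x, y)` as one word `x # y`, the separator `#` being `none`. -/
def encodePair {Γ Δ : Type} (w : List Γ × List Δ) : List (Option (Γ ⊕ Δ)) :=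
  w.1.map (fun a => some (Sum.inl a)) ++ none :: w.2.map (fun b => some (Sum.inr b))

/-- A binary relation between words is decidable in polynomial time if its characteristic
function is computed by a Turing machine in time polynomial in the length of `x # y`. -/
def PolyTimeDecidable {Γ Δ : Type} (R : List Γ → List Δ → Prop) : Prop :=
  ∃ f : List Γ × List Δ → Bool, (∀ x y, f (x, y) = true ↔ R x y) ∧
    Nonempty (Turing.TM2ComputableInPolyTime encodePair Computability.encodeBool f)

/-- `R` is a polynomial-time verifier for `L`: `R` is decidable in polynomial time, only words of
`L` have certificates, and each word of `L` has a certificate of polynomially bounded length. -/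
def IsPolyVerifier {Γ Δ : Type} (R : List Γ → List Δ → Prop) (L : Language Γ) : Prop :=
  PolyTimeDecidable R ∧
  (∀ x y, R x y → x ∈ L) ∧
  ∃ p : Polynomial ℕ, ∀ x ∈ L, ∃ y, y.length ≤ p.eval x.length ∧ R x y

/-- The class NP of languages over the finite alphabet `Γ`. -/
def NP (Γ : Type) [Finite Γ] : Set (Language Γ) :=
  {L | ∃ (Δ : Type) (_ : Finite Δ) (R : List Γ → List Δ → Prop), IsPolyVerifier R L}

/-! ### Encodings, over the alphabet of the two bits and a separator -/

/-- The binary digits of a natural number, followed by the separator. -/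
def encodeNumber (a : ℕ) : List (Option Bool) :=
  a.bits.map some ++ [none]

/-- The vertices before `i`, in increasing order. -/
def verticesBelow {m : ℕ} (i : Fin m) : List (Fin m) :=
  (List.finRange m).filter (fun j => j < i)

open Classical in
/-- The encoding of a graph with a configuration: for each vertex `i` in turn, the number of
pebbles on `i` in binary, and the row of the adjacency matrix of `G` at `i` below the diagonal. -/
noncomputable def encodeInstance {m : ℕ} (G : SimpleGraph (Fin m)) (C : Fin m → ℕ) :
    List (Option Bool) :=
  (List.finRange m).flatMap fun i =>
    encodeNumber (C i) ++ (verticesBelow i).map (fun j => some (decide (G.Adj i j))) ++ [none]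

/-- The encoding of a vector of move counts: for each pair of vertices `j < i` in turn, the
numbers `n i j` and `n j i` in binary. The diagonal, where move counts vanish, is left out. -/
def encodeMoves {m : ℕ} (n : Fin m → Fin m → ℕ) : List (Option Bool) :=
  (List.finRange m).flatMap fun i =>
    (verticesBelow i).flatMap fun j => encodeNumber (n i j) ++ encodeNumber (n j i)

/-- The cover solvability problem: the words that encode a graph together with a configuration
that is cover solvable on it. -/
def coverSolvability : Language (Option Bool) :=
  {x | ∃ (m : ℕ) (G : SimpleGraph (Fin m)) (C : Fin m → ℕ),
    x = encodeInstance G C ∧ CoverSolvable G C}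

/-- `x` encodes a graph with a configuration, and `y` a vector of move counts for them. -/
def MoveCountCertificate (x y : List (Option Bool)) : Prop :=
  ∃ (m : ℕ) (G : SimpleGraph (Fin m)) (C : Fin m → ℕ) (n : Fin m → Fin m → ℕ),
    x = encodeInstance G C ∧ y = encodeMoves n ∧ IsMoveCount G C n

/-! A configuration is cover solvable exactly when it has a vector of move counts. Counting the
moves of a solution gives one direction. For the converse (`coverSolvable_of_isMoveCount`), the
order of the moves has to be recovered from their numbers. If no counted move could be made, every
vertex with outgoing moves would carry at most one pebble, so its balance would force at least twice
as many incoming as outgoing moves; summing over all vertices, the total `T` of the counts satisfies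
`2 * T ≤ T`, so it vanishes. Hence, as long as some count is nonzero, a counted move is available;
making it and lowering its count preserves all balances.

Certificates are short because each move destroys a pebble: every count is at most the number of
pebbles, which is below `2 ^ |x|`. With at most `|x|` vertices this gives a cubic bound
(`exists_short_certificate`).

The relation is decided by `verify`, which treats the vertices one at a time and keeps, in two's
complement, the balance of each vertex relative to the vertices treated so far. A new vertex
contributes one row of `x` and one row of `y`; the pair of counts `u`, `v` for an earlier vertex
adds `u - 2 v` to the earlier balance and `v - 2 u` to the new one. `verify_iff` says that this
decides `MoveCountCertificate`.

For polynomial time, `verify` is realised by a structured program on stacks. `Runs` is a semantics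
with step bounds, and `Runs.stepIter` transfers it to the compiled stack machine. Each addition
lengthens a number by at most three symbols beyond its longest operand, so all widths stay quadratic
and the running time is polynomial (`runs_verifierProg`). -/

/-! ### Structured programs on stacks -/

namespace StackProgram

open Turing

variable {K : Type} {Γ : K → Type} {σ : Type}

/-- A single action on finitely many stacks and a register of type `σ`. -/
inductive Act (Γ : K → Type) (σ : Type)
  | push (k : K) (f : σ → Γ k)
  | peek (k : K) (f : σ → Option (Γ k) → σ)
  | pop (k : K) (f : σ → Option (Γ k) → σ)
  | load (f : σ → σ)

/-- A state consists of the register and the stacks. -/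
abbrev State (Γ : K → Type) (σ : Type) := σ × (∀ k, List (Γ k))

/-- Prepending an action to a statement of the stack machine. -/
def Act.toStmt {Λ : Type} : Act Γ σ → TM2.Stmt Γ Λ σ → TM2.Stmt Γ Λ σ
  | push k f, q => TM2.Stmt.push k f q
  | peek k f, q => TM2.Stmt.peek k f q
  | pop k f, q => TM2.Stmt.pop k f q
  | load f, q => TM2.Stmt.load f q

/-- Prepending a list of actions to a statement of the stack machine. -/
def blockStmt {Λ : Type} : List (Act Γ σ) → TM2.Stmt Γ Λ σ → TM2.Stmt Γ Λ σ
  | [], q => q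
  | a :: l, q => a.toStmt (blockStmt l q)

/-- Structured programs: blocks of actions, sequential composition, and loops, which execute a
block, then test the register, and repeat the body as long as the test succeeds. -/
inductive Prog (Γ : K → Type) (σ : Type)
  | block (l : List (Act Γ σ))
  | seq (p q : Prog Γ σ)
  | loop (l : List (Act Γ σ)) (b : σ → Bool) (p : Prog Γ σ)

/-- The program points of a program. -/
def Prog.Pos : Prog Γ σ → Type
  | block _ => Unit
  | seq p q => p.Pos ⊕ q.Pos
  | loop _ _ p => Option p.Pos

/-- There are only finitely many program points. -/
theorem Prog.finite_pos : ∀ p : Prog Γ σ, Finite p.Pos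
  | block _ => inferInstanceAs (Finite Unit)
  | seq p q =>
    haveI := p.finite_pos
    haveI := q.finite_pos
    inferInstanceAs (Finite (p.Pos ⊕ q.Pos))
  | loop _ _ p =>
    haveI := p.finite_pos
    inferInstanceAs (Finite (Option p.Pos))

/-- The program point at which a program starts. -/
def Prog.entry : (p : Prog Γ σ) → p.Pos
  | block _ => ()
  | seq p _ => Sum.inl p.entry
  | loop _ _ _ => none

/-- The statement at each program point of `p`, where `e` embeds the program points of `p` into
all labels and `cont` is executed after `p`. -/
def Prog.code {Λ : Type} :
    (p : Prog Γ σ) → (p.Pos → Λ) → TM2.Stmt Γ Λ σ → p.Pos → TM2.Stmt Γ Λ σ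
  | block l, _, cont, _ => blockStmt l cont
  | seq p q, e, cont, a =>
    match a with
    | Sum.inl a =>
      p.code (fun a => e (Sum.inl a)) (TM2.Stmt.goto fun _ => e (Sum.inr q.entry)) a
    | Sum.inr a => q.code (fun a => e (Sum.inr a)) cont a
  | loop l b p, e, cont, a =>
    match a with
    | none => blockStmt l (TM2.Stmt.branch b (TM2.Stmt.goto fun _ => e (some p.entry)) cont)
    | some a => p.code (fun a => e (some a)) (TM2.Stmt.goto fun _ => e none) a

variable [DecidableEq K]

/-- The effect of an action. -/
def Act.run : Act Γ σ → State Γ σ → State Γ σ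
  | push k f, s => (s.1, Function.update s.2 k (f s.1 :: s.2 k))
  | peek k f, s => (f s.1 (s.2 k).head?, s.2)
  | pop k f, s => (f s.1 (s.2 k).head?, Function.update s.2 k (s.2 k).tail)
  | load f, s => (f s.1, s.2)

/-- The effect of a list of actions. -/
def runBlock : List (Act Γ σ) → State Γ σ → State Γ σ
  | [], s => s
  | a :: l, s => runBlock l (a.run s)

/-- `Runs p s s' t`: started in the state `s`, the program `p` ends in `s'` after at most `t`
steps. -/
inductive Runs : Prog Γ σ → State Γ σ → State Γ σ → ℕ → Prop
  | block (l : List (Act Γ σ)) (s : State Γ σ) {t : ℕ} (ht : 1 ≤ t) :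
      Runs (Prog.block l) s (runBlock l s) t
  | seq {p q : Prog Γ σ} {s s' s'' : State Γ σ} {t t' t'' : ℕ}
      (h : Runs p s s' t) (h' : Runs q s' s'' t') (ht : t + t' ≤ t'') :
      Runs (Prog.seq p q) s s'' t''
  | loop_exit (l : List (Act Γ σ)) (b : σ → Bool) (p : Prog Γ σ) (s : State Γ σ) {t : ℕ}
      (hb : b (runBlock l s).1 = false) (ht : 1 ≤ t) :
      Runs (Prog.loop l b p) s (runBlock l s) t
  | loop_step {l : List (Act Γ σ)} {b : σ → Bool} {p : Prog Γ σ} {s s' s'' : State Γ σ}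
      {t t' t'' : ℕ} (hb : b (runBlock l s).1 = true) (h : Runs p (runBlock l s) s' t)
      (h' : Runs (Prog.loop l b p) s' s'' t') (ht : 1 + t + t' ≤ t'') :
      Runs (Prog.loop l b p) s s'' t''

theorem Runs.block_eq {l : List (Act Γ σ)} {s s' : State Γ σ} {t : ℕ} (h : runBlock l s = s')
    (ht : 1 ≤ t) : Runs (Prog.block l) s s' t :=
  h ▸ Runs.block l s ht

theorem Runs.loop_exit_eq {l : List (Act Γ σ)} {b : σ → Bool} {p : Prog Γ σ} {s s' : State Γ σ}
    {t : ℕ} (h : runBlock l s = s') (hb : b s'.1 = false) (ht : 1 ≤ t) :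
    Runs (Prog.loop l b p) s s' t := by
  subst h
  exact Runs.loop_exit l b p s hb ht

theorem Runs.loop_step_eq {l : List (Act Γ σ)} {b : σ → Bool} {p : Prog Γ σ}
    {s s₀ s' s'' : State Γ σ} {t t' t'' : ℕ} (h₀ : runBlock l s = s₀) (hb : b s₀.1 = true)
    (h : Runs p s₀ s' t) (h' : Runs (Prog.loop l b p) s' s'' t') (ht : 1 + t + t' ≤ t'') :
    Runs (Prog.loop l b p) s s'' t'' := by
  subst h₀
  exact Runs.loop_step hb h h' ht

/-- A machine step executes a whole statement up to its jump, so a block costs one step whatever its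
length. -/
theorem stepAux_blockStmt {Λ : Type} (l : List (Act Γ σ)) (q : TM2.Stmt Γ Λ σ) (s : State Γ σ) :
    TM2.stepAux (blockStmt l q) s.1 s.2 = TM2.stepAux q (runBlock l s).1 (runBlock l s).2 := by
  induction l generalizing s with
  | nil => rfl
  | cons a l ih =>
    rw [runBlock, ← ih]
    cases a <;> rfl

/-- The iterated step function of a stack machine. -/
def stepIter {Λ : Type} (M : Λ → TM2.Stmt Γ Λ σ) (n : ℕ) (c : TM2.Cfg Γ Λ σ) :
    Option (TM2.Cfg Γ Λ σ) :=
  (flip bind (TM2.step M))^[n] (some c)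

theorem stepIter_add {Λ : Type} {M : Λ → TM2.Stmt Γ Λ σ} {m n : ℕ} {c c' : TM2.Cfg Γ Λ σ}
    (h : stepIter M m c = some c') : stepIter M (m + n) c = stepIter M n c' := by
  rw [stepIter, Nat.add_comm, Function.iterate_add_apply]
  rw [stepIter] at h
  rw [h, stepIter]

/-- Correctness of the compilation, with its cost. The continuation varies in the induction because
a subprogram is compiled with a jump in place of `cont`. -/
theorem Runs.stepIter {Λ : Type} {M : Λ → TM2.Stmt Γ Λ σ} {p : Prog Γ σ} {s s' : State Γ σ}
    {t : ℕ} (h : Runs p s s' t) (e : p.Pos → Λ) (cont : TM2.Stmt Γ Λ σ)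
    (hM : ∀ a, M (e a) = p.code e cont a) :
    ∃ n ≤ t, stepIter M n ⟨some (e p.entry), s.1, s.2⟩ = some (TM2.stepAux cont s'.1 s'.2) := by
  induction h generalizing cont with
  | block l s ht =>
    refine ⟨1, ht, ?_⟩
    change some (TM2.stepAux (M (e ())) s.1 s.2) = _
    rw [hM ()]
    exact congrArg some (stepAux_blockStmt l cont s)
  | @seq p q s s' s'' t t' t'' h h' ht ih ih' =>
    obtain ⟨n, hn, hs⟩ := ih (fun a => e (Sum.inl a)) _ (fun a => hM (Sum.inl a))
    obtain ⟨n', hn', hs'⟩ := ih' (fun a => e (Sum.inr a)) cont (fun a => hM (Sum.inr a))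
    exact ⟨n + n', by omega, (stepIter_add hs).trans hs'⟩
  | loop_exit l b p s hb ht =>
    refine ⟨1, ht, ?_⟩
    change some (TM2.stepAux (M (e none)) s.1 s.2) = _
    rw [hM none]
    refine congrArg some ((stepAux_blockStmt l _ s).trans ?_)
    rw [TM2.stepAux, hb]
    rfl
  | @loop_step l b p s s' s'' t t' t'' hb h h' ht ih ih' =>
    obtain ⟨n, hn, hs⟩ := ih (fun a => e (some a)) _ (fun a => hM (some a))
    obtain ⟨n', hn', hs'⟩ := ih' e cont hM
    refine ⟨1 + (n + n'), by omega, ?_⟩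
    refine (stepIter_add (c' := ⟨some (e (some p.entry)), (runBlock l s).1, (runBlock l s).2⟩)
      ?_).trans ((stepIter_add hs).trans hs')
    change some (TM2.stepAux (M (e none)) s.1 s.2) = _
    rw [hM none]
    refine congrArg some ((stepAux_blockStmt l _ s).trans ?_)
    rw [TM2.stepAux, hb]
    rfl

end StackProgram

/-! ### Move counts and cover solvability -/

theorem isMoveCount_iff_nat {m : ℕ} {G : SimpleGraph (Fin m)} {C : Fin m → ℕ}
    {n : Fin m → Fin m → ℕ} :
    IsMoveCount G C n ↔
      (∀ i j, ¬ G.Adj i j → n i j = 0) ∧ ∀ k, 1 + 2 * ∑ l, n k l ≤ C k + ∑ l, n l k := by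
  refine and_congr_right fun _ => forall_congr' fun k => ?_
  rw [← Nat.cast_sum, ← Nat.cast_sum]
  omega

/-- If move counts do not all vanish, then some move that they count can be made. -/
theorem exists_available_move {m : ℕ} {G : SimpleGraph (Fin m)} {C : Fin m → ℕ}
    {n : Fin m → Fin m → ℕ} (h : IsMoveCount G C n) (hn : ∃ i j, n i j ≠ 0) :
    ∃ i j, n i j ≠ 0 ∧ 2 ≤ C i := by
  by_contra! hC
  obtain ⟨-, hb⟩ := isMoveCount_iff_nat.1 h
  -- A vertex with outgoing moves has at most one pebble here, which the `1` in its balance uses up.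
  have hle : ∀ k, 2 * ∑ l, n k l ≤ ∑ l, n l k := by
    intro k
    by_cases hk : ∃ l, n k l ≠ 0
    · obtain ⟨l, hl⟩ := hk
      have := hC k l hl
      have := hb k
      omega
    · push Not at hk
      simp [hk]
  -- Every move leaves one vertex and enters one, so outgoing and incoming counts have the same
  -- total.
  have hsum : 2 * ∑ k, ∑ l, n k l ≤ ∑ k, ∑ l, n k l := by
    rw [Finset.mul_sum]
    exact (Finset.sum_le_sum fun k _ => hle k).trans_eq Finset.sum_comm
  obtain ⟨i, j, hij⟩ := hn
  have h1 : n i j ≤ ∑ l, n i l :=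
    Finset.single_le_sum (fun _ _ => Nat.zero_le _) (Finset.mem_univ j)
  have h2 : ∑ l, n i l ≤ ∑ k, ∑ l, n k l :=
    Finset.single_le_sum (f := fun k => ∑ l, n k l) (fun _ _ => Nat.zero_le _) (Finset.mem_univ i)
  omega

/-- The configuration after a move from `u` to `v`. -/
def moveConfig {V : Type*} [DecidableEq V] (C : V → ℕ) (u v : V) : V → ℕ :=
  fun w => if w = u then C w - 2 else if w = v then C w + 1 else C w

/-- The move counts with the moves from `u` to `v` changed to `a`. -/
def setCount {m : ℕ} (n : Fin m → Fin m → ℕ) (u v : Fin m) (a : ℕ) : Fin m → Fin m → ℕ :=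
  fun i j => if i = u ∧ j = v then a else n i j

/-- Both corrections are added rather than subtracted, so the same identity serves for lowering and
for raising a count in `ℕ`. -/
theorem sum_setCount_row {m : ℕ} (n : Fin m → Fin m → ℕ) (u v : Fin m) (a : ℕ) (k : Fin m) :
    ∑ l, setCount n u v a k l + (if k = u then n u v else 0) =
      ∑ l, n k l + if k = u then a else 0 := by
  by_cases hk : k = u
  · subst hk
    simp only [setCount, true_and, if_true]
    rw [← Finset.add_sum_erase _ _ (Finset.mem_univ v),
      ← Finset.add_sum_erase _ (fun l => n k l) (Finset.mem_univ v),
      Finset.sum_congr rfl fun l hl => if_neg (Finset.ne_of_mem_erase hl)]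
    simp only [if_true]
    ring
  · simp [setCount, hk]

theorem sum_setCount_col {m : ℕ} (n : Fin m → Fin m → ℕ) (u v : Fin m) (a : ℕ) (k : Fin m) :
    ∑ l, setCount n u v a l k + (if k = v then n u v else 0) =
      ∑ l, n l k + if k = v then a else 0 := by
  simpa [setCount, and_comm] using sum_setCount_row (fun i j => n j i) v u a k

/-- Induction on the total number of moves: an available counted move is made and its count lowered.
Once all counts vanish, the balances say that every vertex has a pebble. -/
theorem coverSolvable_of_isMoveCount {m : ℕ} {G : SimpleGraph (Fin m)} {C : Fin m → ℕ}
    {n : Fin m → Fin m → ℕ} (h : IsMoveCount G C n) : CoverSolvable G C := by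
  induction hN : ∑ k, ∑ l, n k l using Nat.strong_induction_on generalizing C n with
  | _ N ih =>
    obtain ⟨hadj, hb⟩ := isMoveCount_iff_nat.1 h
    by_cases hn : ∃ i j, n i j ≠ 0
    · obtain ⟨u, v, huv, hu⟩ := exists_available_move h hn
      have hG : G.Adj u v := by
        by_contra hG
        exact huv (hadj u v hG)
      have hrow := sum_setCount_row n u v (n u v - 1)
      have hcol := sum_setCount_col n u v (n u v - 1)
      have hlt : ∑ k, ∑ l, setCount n u v (n u v - 1) k l < N := by
        rw [← hN]
        refine Finset.sum_lt_sum (fun k _ => ?_) ⟨u, Finset.mem_univ u, ?_⟩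
        · have := hrow k
          split_ifs at this <;> omega
        · have := hrow u
          simp only [if_true] at this
          omega
      have hcount : IsMoveCount G (moveConfig C u v) (setCount n u v (n u v - 1)) := by
        refine isMoveCount_iff_nat.2 ⟨fun i j hij => ?_, fun k => ?_⟩
        · rw [setCount, if_neg]
          · exact hadj i j hij
          · rintro ⟨rfl, rfl⟩
            exact hij hG
        · have h1 := hrow k
          have h2 := hcol k
          have h3 := hb k
          -- At `u` two pebbles and one outgoing move disappear, at `v` a pebble replaces an
          -- incoming move. The cases exclude each other, and `2 ≤ C u` makes the truncated
          -- subtraction exact.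
          have h4 : ¬ (k = u ∧ k = v) := fun h => hG.ne (h.1 ▸ h.2)
          have h5 : k = u → 2 ≤ C k := fun h => h ▸ hu
          simp only [moveConfig]
          split_ifs at h1 h2 ⊢ <;> omega
      obtain ⟨D, hD, hD1⟩ := ih _ hlt hcount rfl
      exact ⟨D, Relation.ReflTransGen.head ⟨u, v, hG, hu, rfl⟩ hD, hD1⟩
    · push Not at hn
      refine ⟨C, Relation.ReflTransGen.refl, fun k => ?_⟩
      have := hb k
      simpa [hn] using this

/-- The loss of one pebble per move is what bounds the counts. -/
theorem sum_moveConfig {m : ℕ} {C : Fin m → ℕ} {u v : Fin m} (huv : u ≠ v) (hu : 2 ≤ C u) :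
    ∑ k, moveConfig C u v k + 1 = ∑ k, C k := by
  have h : ∀ k, moveConfig C u v k + (if k = u then 2 else 0) = C k + if k = v then 1 else 0 := by
    intro k
    simp only [moveConfig]
    split_ifs with h1 h2 h2
    · exact absurd (h1.symm.trans h2) huv
    · subst h1; omega
    · rfl
    · rfl
  have := Finset.sum_congr (rfl : (Finset.univ : Finset (Fin m)) = _) fun k _ => h k
  simp only [Finset.sum_add_distrib, Finset.sum_ite_eq', Finset.mem_univ, if_true] at this
  omega

/-- A solvable configuration has move counts that are bounded by the number of pebbles. -/
theorem CoverSolvable.exists_isMoveCount {m : ℕ} {G : SimpleGraph (Fin m)} {C : Fin m → ℕ}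
    (h : CoverSolvable G C) :
    ∃ n, IsMoveCount G C n ∧ ∀ i j, n i j ≤ ∑ k, C k := by
  obtain ⟨D, hCD, hD⟩ := h
  induction hCD using Relation.ReflTransGen.head_induction_on with
  | refl => exact ⟨fun _ _ => 0, isMoveCount_iff_nat.2 ⟨by simp, by simpa using hD⟩, by simp⟩
  | @head C C' hmove _ ih =>
    obtain ⟨n, hn, hle⟩ := ih
    obtain ⟨hadj, hb⟩ := isMoveCount_iff_nat.1 hn
    obtain ⟨u, v, hG, hu, rfl⟩ := hmove
    have hsum := sum_moveConfig hG.ne hu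
    change ∀ i j, n i j ≤ ∑ k, moveConfig C u v k at hle
    change ∀ k, _ ≤ moveConfig C u v k + _ at hb
    -- The first move of the sequence is counted in addition. One count rises by one, and by `hsum`
    -- so does the number of pebbles that bounds it.
    refine ⟨setCount n u v (n u v + 1), isMoveCount_iff_nat.2 ⟨fun i j hij => ?_, fun k => ?_⟩,
      fun i j => ?_⟩
    · rw [setCount, if_neg]
      · exact hadj i j hij
      · rintro ⟨rfl, rfl⟩
        exact hij hG
    · have h1 := sum_setCount_row n u v (n u v + 1) k
      have h2 := sum_setCount_col n u v (n u v + 1) k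
      have h3 := hb k
      have h4 : ¬ (k = u ∧ k = v) := fun h => hG.ne (h.1 ▸ h.2)
      have h5 : k = u → 2 ≤ C k := fun h => h ▸ hu
      simp only [moveConfig] at h3
      split_ifs at h1 h2 h3 <;> omega
    · have := hle i j
      have := hle u v
      rw [setCount]
      split_ifs <;> omega

/-! ### The length of certificates -/

theorem length_encodeNumber (a : ℕ) : (encodeNumber a).length = a.size + 1 := by
  simp [encodeNumber, Nat.size_eq_bits_len]

/-- Adding two numbers costs at most one extra bit, and the separator of each encoded number, the `+
1`, pays for it. -/
theorem sum_map_lt_two_pow {α : Type*} (C : α → ℕ) (l : List α) :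
    (l.map C).sum < 2 ^ (l.map fun i => (C i).size + 1).sum := by
  induction l with
  | nil => simp
  | cons a l ih =>
    have h := Nat.lt_size_self (C a)
    have h1 : 2 ^ (C a).size ≤ 2 ^ ((C a).size + (l.map fun i => (C i).size + 1).sum) :=
      Nat.pow_le_pow_right (by norm_num) (Nat.le_add_right _ _)
    have h2 : 2 ^ (l.map fun i => (C i).size + 1).sum ≤
        2 ^ ((C a).size + (l.map fun i => (C i).size + 1).sum) :=
      Nat.pow_le_pow_right (by norm_num) (Nat.le_add_left _ _)
    have h3 : 2 ^ ((C a).size + 1 + (l.map fun i => (C i).size + 1).sum) =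
        2 * 2 ^ ((C a).size + (l.map fun i => (C i).size + 1).sum) := by
      rw [← pow_succ']
      congr 1
      omega
    simp only [List.map_cons, List.sum_cons]
    omega

theorem length_encodeInstance {m : ℕ} (G : SimpleGraph (Fin m)) (C : Fin m → ℕ) :
    (encodeInstance G C).length = ((List.finRange m).map fun i =>
      ((C i).size + 1) + ((verticesBelow i).length + 1)).sum := by
  simp [encodeInstance, List.length_flatMap, length_encodeNumber, Nat.add_assoc]

theorem card_le_length_encodeInstance {m : ℕ} (G : SimpleGraph (Fin m)) (C : Fin m → ℕ) :
    m ≤ (encodeInstance G C).length := by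
  rw [length_encodeInstance]
  calc m = ((List.finRange m).map fun _ => 1).sum := by simp
    _ ≤ _ := List.sum_le_sum fun i _ => by omega

theorem sum_lt_two_pow_length_encodeInstance {m : ℕ} (G : SimpleGraph (Fin m)) (C : Fin m → ℕ) :
    ∑ k, C k < 2 ^ (encodeInstance G C).length := by
  rw [Fin.sum_univ_def]
  refine (sum_map_lt_two_pow C _).trans_le (Nat.pow_le_pow_right (by norm_num) ?_)
  rw [length_encodeInstance]
  exact List.sum_le_sum fun i _ => by omega

theorem length_encodeMoves_le {m s : ℕ} {n : Fin m → Fin m → ℕ} (h : ∀ i j, n i j < 2 ^ s) :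
    (encodeMoves n).length ≤ m * (m * (2 * (s + 1))) := by
  have hb (i : Fin m) : (verticesBelow i).length ≤ m := by
    simpa [verticesBelow] using List.length_filter_le (fun j => decide (j < i)) (List.finRange m)
  have hsize (i j) : (n i j).size ≤ s := Nat.size_le.2 (h i j)
  have hrow (i : Fin m) : ((verticesBelow i).flatMap fun j =>
      encodeNumber (n i j) ++ encodeNumber (n j i)).length ≤ m * (2 * (s + 1)) := by
    rw [List.length_flatMap]
    refine (List.sum_le_card_nsmul _ (2 * (s + 1)) ?_).trans ?_
    · intro a ha
      obtain ⟨j, -, rfl⟩ := List.mem_map.1 ha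
      have := hsize i j
      have := hsize j i
      simp only [List.length_append, length_encodeNumber]
      omega
    · rw [List.length_map, smul_eq_mul]
      exact Nat.mul_le_mul_right _ (hb i)
  rw [encodeMoves, List.length_flatMap]
  refine (List.sum_le_card_nsmul _ (m * (2 * (s + 1))) ?_).trans ?_
  · intro a ha
    obtain ⟨i, -, rfl⟩ := List.mem_map.1 ha
    exact hrow i
  · simp

theorem exists_short_certificate {x : List (Option Bool)} (hx : x ∈ coverSolvability) :
    ∃ y, y.length ≤ x.length * (x.length * (2 * (x.length + 1))) ∧ MoveCountCertificate x y := by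
  obtain ⟨m, G, C, rfl, h⟩ := hx
  obtain ⟨n, hn, hle⟩ := h.exists_isMoveCount
  have hm := card_le_length_encodeInstance G C
  refine ⟨encodeMoves n, (length_encodeMoves_le fun i j =>
    (hle i j).trans_lt (sum_lt_two_pow_length_encodeInstance G C)).trans ?_,
    m, G, C, n, rfl, rfl, hn⟩
  gcongr

theorem mem_coverSolvability_of_certificate {x y : List (Option Bool)}
    (h : MoveCountCertificate x y) : x ∈ coverSolvability := by
  obtain ⟨m, G, C, n, hx, -, hn⟩ := h
  exact ⟨m, G, C, hx, coverSolvable_of_isMoveCount hn⟩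

/-! ### The verifier as a function on words -/

namespace CoverVerifier

/-- The symbols on the working stacks: bits, and two separators. A separator ends a number and
carries its sign. -/
abbrev Sym := Bool ⊕ Bool

/-- The letters of the input as symbols. -/
def toSym : Option Bool → Sym
  | some b => Sum.inl b
  | none => Sum.inr false

theorem toSym_injective : Function.Injective toSym := by
  rintro (_ | a) (_ | b) h <;> simp_all [toSym]

/-! ### Two's complement arithmetic, digit by digit -/

/-- The value of a symbol as a digit. -/
def digit : Option Sym → ℤ
  | none => 0
  | some (Sum.inl b) => if b then 1 else 0
  | some (Sum.inr s) => if s then -1 else 0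

theorem digit_bounds (s : Option Sym) : -1 ≤ digit s ∧ digit s ≤ 1 := by
  rcases s with _ | (_ | _) | (_ | _) <;> simp [digit]

/-- The integer represented by a list of symbols, in two's complement if the last symbol is a
separator. -/
def symValue : List Sym → ℤ
  | [] => 0
  | s :: l => digit (some s) + 2 * symValue l

/-- An exhausted list supplies zeros. No sign extension is needed, since the sign is itself a digit
`-1` in top position; this lets operands of different lengths be combined. -/
theorem symValue_eq_head_tail (l : List Sym) :
    symValue l = digit l.head? + 2 * symValue l.tail := by
  cases l <;> simp [symValue, digit]

/-- An integer in two's complement: its bits, the lowest first, and its sign. -/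
abbrev Acc := List Bool × Bool

/-- The list of symbols that represents an integer in two's complement. -/
def accSyms (a : Acc) : List Sym := a.1.map Sum.inl ++ [Sum.inr a.2]

/-- The integer represented in two's complement. -/
def accValue (a : Acc) : ℤ := symValue (accSyms a)

/-- The carries that occur when a combination `p + u - 2 v` is computed digit by digit. -/
abbrev Carry := {c : ℤ // c ∈ Finset.Icc (-4 : ℤ) 3}

/-- The sum of the digits and the carry at one position. -/
def digitSum (c : Carry) (p u v : Option Sym) : ℤ := digit p + c.1 + digit u - 2 * digit v

/-- The carry to the next position. -/
def nextCarry (c : Carry) (p u v : Option Sym) : Carry :=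
  ⟨digitSum c p u v / 2, by
    -- Digits in `[-1, 1]` and a carry in `[-4, 3]` give a digit sum in `[-8, 7]`, whose floored
    -- half is in `[-4, 3]` again.
    have hc := Finset.mem_Icc.1 c.2
    have hp := digit_bounds p
    have hu := digit_bounds u
    have hv := digit_bounds v
    rw [Finset.mem_Icc, digitSum]
    omega⟩

/-- The bit at one position. -/
def outBit (c : Carry) (p u v : Option Sym) : Bool := decide (digitSum c p u v % 2 = 1)

/-- The carry zero. -/
def zeroCarry : Carry := ⟨0, by simp⟩

/-- The lowest `n` bits of `p + c + u - 2 v`, and the remaining carry. -/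
def sumBits : ℕ → Carry → List Sym → List Sym → List Sym → List Bool × Carry
  | 0, c, _, _, _ => ([], c)
  | n + 1, c, p, u, v =>
    let r := sumBits n (nextCarry c p.head? u.head? v.head?) p.tail u.tail v.tail
    (outBit c p.head? u.head? v.head? :: r.1, r.2)

/-- The lowest bit of a carry. -/
def carryBit₀ (c : Carry) : Bool := decide (c.1 % 2 = 1)

/-- The second bit of a carry. -/
def carryBit₁ (c : Carry) : Bool := decide (c.1 / 2 % 2 = 1)

/-- The sign of a carry. -/
def carrySign (c : Carry) : Bool := decide (c.1 < 0)

/-- The number `p + u - 2 v`, where `p`, `u` and `v` have at most `n` digits. -/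
def addAcc (n : ℕ) (p u v : List Sym) : Acc :=
  let r := sumBits n zeroCarry p u v
  (r.1 ++ [carryBit₀ r.2, carryBit₁ r.2], carrySign r.2)

theorem ite_mod_two (t : ℤ) : (if t % 2 = 1 then (1 : ℤ) else 0) = t % 2 := by
  split_ifs <;> omega

theorem digit_outBit (c : Carry) (p u v : Option Sym) :
    digit (some (Sum.inl (outBit c p u v))) = digitSum c p u v % 2 := by
  simp [digit, outBit, ite_mod_two]

/-- Two bits and a sign represent exactly the range `[-4, 3]`, so the final carry takes three
symbols. -/
theorem symValue_carry (c : Carry) :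
    symValue [Sum.inl (carryBit₀ c), Sum.inl (carryBit₁ c), Sum.inr (carrySign c)] = c.1 := by
  have hc := Finset.mem_Icc.1 c.2
  simp only [symValue, digit, carryBit₀, carryBit₁, carrySign, decide_eq_true_eq, ite_mod_two]
  split_ifs <;> omega

/-- At each position the digit sum is the output bit plus twice the next carry. Here `l` is any way
of writing the carry left after `n` positions, where all operands are exhausted. -/
theorem symValue_sumBits {n : ℕ} {p u v : List Sym} (c : Carry) (hp : p.length ≤ n)
    (hu : u.length ≤ n) (hv : v.length ≤ n) (l : List Sym)
    (hl : symValue l = (sumBits n c p u v).2.1) :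
    symValue ((sumBits n c p u v).1.map Sum.inl ++ l) =
      symValue p + c.1 + symValue u - 2 * symValue v := by
  induction n generalizing c p u v with
  | zero =>
    simp only [Nat.le_zero, List.length_eq_zero_iff] at hp hu hv
    subst hp hu hv
    simpa [sumBits, symValue] using hl
  | succ n ih =>
    have h := ih (nextCarry c p.head? u.head? v.head?) (p := p.tail) (u := u.tail) (v := v.tail)
      (by simp; omega) (by simp; omega) (by simp; omega) hl
    simp only [sumBits, List.map_cons, List.cons_append, symValue, digit_outBit]
    rw [h, symValue_eq_head_tail p, symValue_eq_head_tail u, symValue_eq_head_tail v, nextCarry]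
    simp only [digitSum]
    omega

theorem accValue_addAcc {n : ℕ} {p u v : List Sym} (hp : p.length ≤ n) (hu : u.length ≤ n)
    (hv : v.length ≤ n) :
    accValue (addAcc n p u v) = symValue p + symValue u - 2 * symValue v := by
  have h := symValue_sumBits zeroCarry hp hu hv _ (symValue_carry _)
  simpa [accValue, accSyms, addAcc, zeroCarry] using h

theorem length_sumBits (n : ℕ) (c : Carry) (p u v : List Sym) :
    (sumBits n c p u v).1.length = n := by
  induction n generalizing c p u v with
  | zero => rfl
  | succ n ih => simp [sumBits, ih]

theorem length_accSyms_addAcc (n : ℕ) (p u v : List Sym) :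
    (accSyms (addAcc n p u v)).length = n + 3 := by
  simp [accSyms, addAcc, length_sumBits]

/-- Whether an integer in two's complement is positive. -/
def accPos (a : Acc) : Bool := !a.2 && a.1.any id

theorem accValue_cons (b : Bool) (l : List Bool) (s : Bool) :
    accValue (b :: l, s) = (if b then 1 else 0) + 2 * accValue (l, s) := rfl

/-- A set sign outweighs all bits below it; without it the value is zero only if every bit is. -/
theorem accPos_iff (a : Acc) : accPos a = true ↔ 1 ≤ accValue a := by
  obtain ⟨l, s⟩ := a
  cases s with
  | false =>
    have h : 0 ≤ accValue (l, false) ∧ (accPos (l, false) = true ↔ 1 ≤ accValue (l, false)) := by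
      induction l with
      | nil => simp [accPos, accValue, accSyms, symValue, digit]
      | cons b l ih =>
        rw [accValue_cons]
        cases b with
        | false =>
          have : accPos (false :: l, false) = accPos (l, false) := by simp [accPos]
          rw [this, ih.2]
          simp only [Bool.false_eq_true, if_false]
          omega
        | true =>
          have : accPos (true :: l, false) = true := by simp [accPos]
          simp only [this, if_true, true_iff]
          omega
    exact h.2
  | true =>
    have h : accValue (l, true) < 0 := by
      induction l with
      | nil => simp [accValue, accSyms, symValue, digit]
      | cons b l ih =>
        rw [accValue_cons]
        split_ifs <;> omega
    simp only [accPos, Bool.not_true, Bool.false_and, Bool.false_eq_true, false_iff]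
    omega

/-! ### Parsing binary numbers -/

/-- The result of reading a word up to the first separator. -/
structure Block where
  bits : List Bool
  terminal : Option Sym
  rest : List Sym

/-- Reading a word up to the first separator. -/
def readBlock : List Sym → Block
  | [] => ⟨[], none, []⟩
  | Sum.inl b :: l => ⟨b :: (readBlock l).bits, (readBlock l).terminal, (readBlock l).rest⟩
  | Sum.inr s :: l => ⟨[], some (Sum.inr s), l⟩

/-- Whether a block is the binary representation of a natural number. -/
def Block.isNumber (r : Block) : Bool :=
  decide (r.terminal = some (Sum.inr false)) && decide (r.bits.getLast? ≠ some false)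

/-- The bits of a block as symbols. -/
def Block.syms (r : Block) : List Sym := r.bits.map Sum.inl

theorem readBlock_bits_append (l : List Bool) (s : Bool) (w : List Sym) :
    readBlock (l.map Sum.inl ++ Sum.inr s :: w) = ⟨l, some (Sum.inr s), w⟩ := by
  induction l with
  | nil => rfl
  | cons b l ih => simp [readBlock, ih]

theorem readBlock_accSyms_append (a : Acc) (w : List Sym) :
    readBlock (accSyms a ++ w) = ⟨a.1, some (Sum.inr a.2), w⟩ := by
  simpa [accSyms] using readBlock_bits_append a.1 a.2 w

theorem eq_of_readBlock_terminal {w : List Sym} {s : Bool}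
    (h : (readBlock w).terminal = some (Sum.inr s)) :
    w = (readBlock w).bits.map Sum.inl ++ Sum.inr s :: (readBlock w).rest := by
  induction w with
  | nil => simp [readBlock] at h
  | cons a w ih =>
    cases a with
    | inl b => simpa [readBlock] using ih h
    | inr s' => simpa [readBlock] using h

theorem length_readBlock_rest (w : List Sym) :
    (readBlock w).bits.length + (readBlock w).rest.length ≤ w.length := by
  induction w with
  | nil => simp [readBlock]
  | cons a w ih =>
    cases a with
    | inl b => simp only [readBlock, List.length_cons]; omega
    | inr s' => simp [readBlock]

theorem length_readBlock_rest_lt {w : List Sym} (hw : w ≠ []) :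
    (readBlock w).rest.length < w.length := by
  cases w with
  | nil => exact absurd rfl hw
  | cons a w =>
    cases a with
    | inl b =>
      have := length_readBlock_rest w
      simp only [readBlock, List.length_cons]
      omega
    | inr s' => simp [readBlock]

/-- The lowest bit comes first, so the last one is the leading bit. With `exists_bits_eq` this
characterises canonical binary words; the verifier must reject the others, as they encode nothing.
-/
theorem getLast?_bits_ne (a : ℕ) : a.bits.getLast? ≠ some false := by
  induction a using Nat.binaryRec' with
  | zero => simp
  | bit b a h ih =>
    rw [Nat.bits_append_bit a b h]
    rcases ha : a.bits with _ | ⟨c, l⟩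
    · have : a = 0 := by
        have := Nat.size_eq_bits_len a
        rw [ha] at this
        exact Nat.size_eq_zero.1 this.symm
      simp [h this]
    · rw [List.getLast?_cons_cons, ← ha]
      exact ih

theorem exists_bits_eq {l : List Bool} (h : l.getLast? ≠ some false) : ∃ a : ℕ, a.bits = l := by
  induction l with
  | nil => exact ⟨0, Nat.zero_bits⟩
  | cons b l ih =>
    rcases l with _ | ⟨c, l⟩
    · have hb : b = true := by simpa using h
      exact ⟨1, by rw [hb, Nat.one_bits]⟩
    · rw [List.getLast?_cons_cons] at h
      obtain ⟨a, ha⟩ := ih h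
      refine ⟨Nat.bit b a, ?_⟩
      rw [Nat.bits_append_bit a b, ha]
      rintro rfl
      simp at ha

theorem symValue_bits (a : ℕ) : symValue (a.bits.map Sum.inl) = a := by
  induction a using Nat.binaryRec' with
  | zero => simp [symValue]
  | bit b a h ih =>
    rw [Nat.bits_append_bit a b h, List.map_cons, symValue, ih, Nat.bit_val]
    cases b <;> simp [digit, add_comm]

theorem accValue_bits (a : ℕ) : accValue (a.bits, false) = a := by
  have h (l : List Bool) : accValue (l, false) = symValue (l.map Sum.inl) := by
    induction l with
    | nil => rfl
    | cons b l ih => rw [accValue_cons, ih]; rfl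
  rw [h, symValue_bits]

/-- The binary representation of a number as a list of symbols. -/
def numSyms (a : ℕ) : List Sym := a.bits.map Sum.inl ++ [Sum.inr false]

theorem map_toSym_encodeNumber (a : ℕ) : (encodeNumber a).map toSym = numSyms a := by
  simp [encodeNumber, numSyms, toSym, Function.comp_def]

theorem readBlock_numSyms_append (a : ℕ) (w : List Sym) :
    readBlock (numSyms a ++ w) = ⟨a.bits, some (Sum.inr false), w⟩ := by
  simpa [numSyms] using readBlock_bits_append a.bits false w

theorem exists_numSyms_append {w : List Sym} (h : (readBlock w).isNumber = true) :
    ∃ a, w = numSyms a ++ (readBlock w).rest := by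
  simp only [Block.isNumber, Bool.and_eq_true, decide_eq_true_eq] at h
  obtain ⟨a, ha⟩ := exists_bits_eq h.2
  refine ⟨a, ?_⟩
  rw [numSyms, ha]
  simpa using eq_of_readBlock_terminal h.1

theorem isNumber_bits (a : ℕ) (w : List Sym) :
    Block.isNumber ⟨a.bits, some (Sum.inr false), w⟩ = true := by
  simp [Block.isNumber, getLast?_bits_ne]

/-! ### The row-by-row verifier and its correctness -/

/-- The state of the verifier within a row: the accumulators already updated, the words not yet
read, the accumulator of the current vertex, and whether no error has occurred. -/
structure Pass where
  accs : List Acc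
  x : List Sym
  y : List Sym
  d : Acc
  ok : Bool

/-- Whether a symbol is a bit. -/
def isBit : Option Sym → Bool
  | some (Sum.inl _) => true
  | _ => false

/-- Whether a symbol is the bit one. -/
def isOne : Option Sym → Bool
  | some (Sum.inl b) => b
  | _ => false

/-- The number of digits needed to process the entry at the accumulators `a` and `d`. -/
def passWidth (a d : Acc) (u v : Block) : ℕ :=
  max (max (accSyms a).length (accSyms d).length) (max u.syms.length v.syms.length)

/-- Whether the entry at one pair of vertices is admissible. -/
def entryOk (s : Option Sym) (u v : Block) : Bool :=
  isBit s && u.isNumber && v.isNumber && (isOne s || (u.bits.isEmpty && v.bits.isEmpty))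

/-- Processing a row of the adjacency matrix together with the move counts. -/
def passRow : List Acc → List Sym → List Sym → Acc → Bool → Pass
  | [], x, y, d, ok => ⟨[], x, y, d, ok⟩
  | a :: l, x, y, d, ok =>
    let u := readBlock y
    let v := readBlock u.rest
    let n := passWidth a d u v
    let r := passRow l x.tail v.rest (addAcc n (accSyms d) v.syms u.syms)
      (ok && entryOk x.head? u v)
    ⟨addAcc n (accSyms a) u.syms v.syms :: r.accs, r.x, r.y, r.d, r.ok⟩

/-- The state of the verifier between rows. -/
structure Outcome where
  accs : List Acc
  y : List Sym
  ok : Bool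

/-- Processing all rows; the first argument bounds their number. -/
def passRows : ℕ → List Sym → List Sym → List Acc → Bool → Outcome
  | 0, _, y, accs, ok => ⟨accs, y, ok⟩
  | n + 1, x, y, accs, ok =>
    if x = [] then ⟨accs, y, ok⟩ else
      let c := readBlock x
      let r := passRow accs c.rest y (c.bits, false) (ok && c.isNumber)
      passRows n r.x.tail r.y (r.accs ++ [r.d]) (r.ok && decide (r.x.head? = some (Sum.inr false)))

/-- The verifier. -/
def verify (x y : List (Option Bool)) : Bool :=
  let r := passRows x.length (x.map toSym) (y.map toSym) [] true
  r.ok && r.y.isEmpty && r.accs.all accPos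

/-- An entry consists of a bit of the adjacency matrix and the two move counts. -/
abbrev Entry := Bool × ℕ × ℕ

/-- The bits of a row of the adjacency matrix. -/
def entriesX (es : List Entry) : List Sym := es.map fun e => Sum.inl e.1

/-- The move counts of a row. -/
def entriesY (es : List Entry) : List Sym :=
  es.flatMap fun e => numSyms e.2.1 ++ numSyms e.2.2

/-- Moves are counted on edges only. -/
def Entry.valid (e : Entry) : Bool := e.1 || (e.2.1 == 0 && e.2.2 == 0)

theorem bits_isEmpty (a : ℕ) : a.bits.isEmpty = (a == 0) := by
  rw [Bool.eq_iff_iff, List.isEmpty_iff, beq_iff_eq, ← List.length_eq_zero_iff,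
    Nat.size_eq_bits_len, Nat.size_eq_zero]

/-- Evaluation on well-formed rows. `passWidth` covers all four operands, so both additions at an
entry are exact. -/
theorem passRow_entries (accs : List Acc) (es : List Entry) (hl : es.length = accs.length)
    (x y : List Sym) (d : Acc) (ok : Bool) :
    let r := passRow accs (entriesX es ++ x) (entriesY es ++ y) d ok
    r.x = x ∧ r.y = y ∧ r.ok = (ok && es.all Entry.valid) ∧
      r.accs.map accValue =
        List.zipWith (fun (a : ℤ) (e : Entry) => a + e.2.1 - 2 * e.2.2) (accs.map accValue) es ∧
      accValue r.d = accValue d + (es.map fun e => (e.2.2 : ℤ) - 2 * e.2.1).sum := by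
  induction accs generalizing es d ok with
  | nil =>
    obtain rfl : es = [] := by simpa using hl
    simp [passRow, entriesX, entriesY]
  | cons a l ih =>
    rcases es with _ | ⟨⟨b, i, j⟩, es⟩
    · simp at hl
    have hx : entriesX ((b, i, j) :: es) ++ x = Sum.inl b :: (entriesX es ++ x) := rfl
    have hy : entriesY ((b, i, j) :: es) ++ y = numSyms i ++ (numSyms j ++ (entriesY es ++ y)) := by
      simp [entriesY]
    have hu : readBlock (entriesY ((b, i, j) :: es) ++ y) =
        ⟨i.bits, some (Sum.inr false), numSyms j ++ (entriesY es ++ y)⟩ := by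
      rw [hy, readBlock_numSyms_append]
    have hok : entryOk (some (Sum.inl b))
        ⟨i.bits, some (Sum.inr false), numSyms j ++ (entriesY es ++ y)⟩
        ⟨j.bits, some (Sum.inr false), entriesY es ++ y⟩ = Entry.valid (b, i, j) := by
      simp [entryOk, isBit, isOne, isNumber_bits, Entry.valid, bits_isEmpty]
    simp only [passRow, hx, hu, readBlock_numSyms_append, List.head?_cons, List.tail_cons, hok]
    obtain ⟨h1, h2, h3, h4, h5⟩ := ih es (by simpa using hl) _ _
    refine ⟨h1, h2, ?_, ?_, ?_⟩
    · rw [h3]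
      simp [Bool.and_assoc]
    · simp only [List.map_cons, List.zipWith_cons_cons, h4]
      congr 1
      rw [accValue_addAcc (by simp [passWidth]) (by simp [passWidth]) (by simp [passWidth])]
      simp only [Block.syms, symValue_bits, accValue]
    · rw [h5, accValue_addAcc (by simp [passWidth]) (by simp [passWidth]) (by simp [passWidth])]
      simp only [Block.syms, symValue_bits, accValue, List.map_cons, List.sum_cons]
      ring

/-- The flag only ever loses truth, so a final `true` means that every check passed, and each check
exposes one entry. Only the shape is recovered; `passRow_entries` then gives the values. -/
theorem exists_entries_of_passRow (accs : List Acc) (x y : List Sym) (d : Acc) (ok : Bool)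
    (h : (passRow accs x y d ok).ok = true) :
    ok = true ∧ ∃ es : List Entry, es.length = accs.length ∧
      x = entriesX es ++ (passRow accs x y d ok).x ∧
      y = entriesY es ++ (passRow accs x y d ok).y := by
  induction accs generalizing x y d ok with
  | nil => exact ⟨h, [], rfl, rfl, rfl⟩
  | cons a l ih =>
    simp only [passRow] at h ⊢
    obtain ⟨hok, es, hl, hx, hy⟩ := ih _ _ _ _ h
    simp only [entryOk, Bool.and_eq_true] at hok
    obtain ⟨hok, ⟨⟨hb, hu⟩, hv⟩, -⟩ := hok
    obtain ⟨i, hi⟩ := exists_numSyms_append hu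
    obtain ⟨j, hj⟩ := exists_numSyms_append hv
    obtain ⟨b, x', rfl⟩ : ∃ b x', x = Sum.inl b :: x' := by
      rcases x with _ | ⟨b | s, x'⟩
      · simp [isBit] at hb
      · exact ⟨b, x', rfl⟩
      · simp [isBit] at hb
    refine ⟨hok, (b, i, j) :: es, by simp [hl], ?_, ?_⟩
    · rw [List.tail_cons] at hx
      simpa [entriesX] using hx
    · conv_lhs => rw [hi, hj, hy]
      simp [entriesY]

/-- The part of an instance that belongs to the vertex `i`. -/
def rowX (C : ℕ → ℕ) (e : ℕ → ℕ → Entry) (i : ℕ) : List Sym :=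
  numSyms (C i) ++ (entriesX ((List.range i).map (e i)) ++ [Sum.inr false])

/-- The part of a certificate that belongs to the vertex `i`. -/
def rowY (e : ℕ → ℕ → Entry) (i : ℕ) : List Sym := entriesY ((List.range i).map (e i))

/-- The number of moves from `i` to `j`. -/
def moves (e : ℕ → ℕ → Entry) (i j : ℕ) : ℕ :=
  if j < i then (e i j).2.1 else if i < j then (e j i).2.2 else 0

/-- The balance at the vertex `k` when only vertices below `m` are taken into account. -/
def balance (C : ℕ → ℕ) (e : ℕ → ℕ → Entry) (m k : ℕ) : ℤ :=
  C k + ((List.range m).map fun l => (moves e l k : ℤ) - 2 * moves e k l).sum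

/-- A further vertex changes an old balance by a single pair of counts, which is the update made by
`passRow`. -/
theorem balance_succ (C : ℕ → ℕ) (e : ℕ → ℕ → Entry) (m k : ℕ) :
    balance C e (m + 1) k = balance C e m k + moves e m k - 2 * moves e k m := by
  simp [balance, List.range_succ]
  ring

theorem zipWith_map_same {α β γ δ : Type*} (f : β → γ → δ) (g : α → β) (h : α → γ) (l : List α) :
    List.zipWith f (l.map g) (l.map h) = l.map fun a => f (g a) (h a) := by
  induction l with
  | nil => rfl
  | cons a l ih => simp [ih]

/-- The invariant is `ha`: before row `i` the accumulators hold the balances of the first `i`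
vertices relative to each other. The bound `n` may exceed the number `k` of rows left, since the
recursion stops at the empty word. -/
theorem passRows_rows (C : ℕ → ℕ) (e : ℕ → ℕ → Entry) (k n i : ℕ) (hk : k ≤ n)
    (accs : List Acc) (hl : accs.length = i)
    (ha : accs.map accValue = (List.range i).map (balance C e i)) (y : List Sym) (ok : Bool) :
    let r := passRows n ((List.range' i k).flatMap (rowX C e))
      ((List.range' i k).flatMap (rowY e) ++ y) accs ok
    r.y = y ∧
      r.ok = (ok && (List.range' i k).all fun i => ((List.range i).map (e i)).all Entry.valid) ∧
      r.accs.map accValue = (List.range (i + k)).map (balance C e (i + k)) := by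
  induction k generalizing n i accs ok with
  | zero => cases n <;> simp [passRows, ha]
  | succ k ih =>
    obtain ⟨n, rfl⟩ := Nat.exists_eq_add_of_le' (Nat.lt_of_lt_of_le (Nat.succ_pos k) hk)
    have hx : (List.range' i (k + 1)).flatMap (rowX C e) = numSyms (C i) ++
        (entriesX ((List.range i).map (e i)) ++
          (Sum.inr false :: (List.range' (i + 1) k).flatMap (rowX C e))) := by
      simp [List.range'_succ, rowX]
    have hy : (List.range' i (k + 1)).flatMap (rowY e) ++ y =
        entriesY ((List.range i).map (e i)) ++
          ((List.range' (i + 1) k).flatMap (rowY e) ++ y) := by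
      simp [List.range'_succ, rowY]
    have hne : (List.range' i (k + 1)).flatMap (rowX C e) ≠ [] := by
      rw [hx]
      simp [numSyms]
    simp only [passRows, if_neg hne]
    rw [hx, hy, readBlock_numSyms_append]
    simp only [isNumber_bits, Bool.and_true]
    have h := passRow_entries accs ((List.range i).map (e i)) (by simp [hl])
      (Sum.inr false :: (List.range' (i + 1) k).flatMap (rowX C e))
      ((List.range' (i + 1) k).flatMap (rowY e) ++ y) ((C i).bits, false) ok
    generalize passRow accs _ _ _ _ = r at h ⊢
    obtain ⟨h1, h2, h3, h4, h5⟩ := h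
    have hlen : r.accs.length = i := by simpa [hl] using congrArg List.length h4
    have hval : (r.accs ++ [r.d]).map accValue =
        (List.range (i + 1)).map (balance C e (i + 1)) := by
      rw [List.map_append, h4, ha, List.map_singleton, h5, zipWith_map_same, List.range_succ,
        List.map_append, List.map_singleton]
      refine congrArg₂ _ (List.map_congr_left fun k hk => ?_) ?_
      · have hk := List.mem_range.1 hk
        rw [balance_succ]
        simp [moves, hk, hk.not_gt]
      -- The new vertex has no moves to itself, so its balance is its pebbles plus the entries of
      -- its own row.
      · rw [balance_succ, accValue_bits, balance, List.map_map]
        simp only [moves, lt_irrefl, if_false, Nat.cast_zero, mul_zero, add_zero, sub_zero]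
        congr 3
        refine List.map_congr_left fun j hj => ?_
        have hj := List.mem_range.1 hj
        simp [hj, hj.not_gt]
    obtain ⟨g1, g2, g3⟩ := ih n (i + 1) (by omega) (r.accs ++ [r.d]) (by simp [hlen]) hval
      (ok && ((List.range i).map (e i)).all Entry.valid)
    rw [show i + 1 + k = i + (k + 1) by omega] at g3
    simp only [h1, h2, h3, List.tail_cons, List.head?_cons, decide_true, Bool.and_true]
    refine ⟨g1, ?_, g3⟩
    rw [g2, List.range'_succ, List.all_cons, Bool.and_assoc]

theorem length_passRow_accs (accs : List Acc) (x y : List Sym) (d : Acc) (ok : Bool) :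
    (passRow accs x y d ok).accs.length = accs.length := by
  induction accs generalizing x y d ok with
  | nil => rfl
  | cons a l ih => simp [passRow, ih]

theorem length_passRow_x (accs : List Acc) (x y : List Sym) (d : Acc) (ok : Bool) :
    (passRow accs x y d ok).x.length ≤ x.length := by
  induction accs generalizing x y d ok with
  | nil => exact le_rfl
  | cons a l ih =>
    refine (ih _ _ _ _).trans ?_
    simp

theorem exists_rows_of_passRows (n : ℕ) (x y : List Sym) (hx : x.length ≤ n) (accs : List Acc)
    (ok : Bool) (h : (passRows n x y accs ok).ok = true) :
    ok = true ∧ ∃ (k : ℕ) (C : ℕ → ℕ) (e : ℕ → ℕ → Entry), k ≤ n ∧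
      x = (List.range' accs.length k).flatMap (rowX C e) ∧
      y = (List.range' accs.length k).flatMap (rowY e) ++ (passRows n x y accs ok).y := by
  induction n generalizing x y accs ok with
  | zero =>
    obtain rfl : x = [] := by simpa using hx
    exact ⟨h, 0, fun _ => 0, fun _ _ => (false, 0, 0), le_rfl, by simp, by simp [passRows]⟩
  | succ n ih =>
    by_cases hne : x = []
    · subst hne
      refine ⟨by simpa [passRows] using h, 0, fun _ => 0, fun _ _ => (false, 0, 0), by omega,
        by simp, by simp [passRows]⟩
    · simp only [passRows, if_neg hne] at h ⊢
      have hrest := length_readBlock_rest_lt hne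
      have hx' := length_passRow_x accs (readBlock x).rest y ((readBlock x).bits, false)
        (ok && (readBlock x).isNumber)
      have hl := length_passRow_accs accs (readBlock x).rest y ((readBlock x).bits, false)
        (ok && (readBlock x).isNumber)
      have hp := exists_entries_of_passRow accs (readBlock x).rest y ((readBlock x).bits, false)
        (ok && (readBlock x).isNumber)
      generalize passRow accs _ _ _ _ = r at h hx' hl hp ⊢
      obtain ⟨hok, k, C, e, hk, hX, hY⟩ := ih _ _ (by simp; omega) _ _ h
      rw [Bool.and_eq_true, decide_eq_true_eq] at hok
      obtain ⟨hok', es, hes, hX', hY'⟩ := hp hok.1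
      rw [Bool.and_eq_true] at hok'
      obtain ⟨a, ha⟩ := exists_numSyms_append hok'.2
      have hrx : r.x = Sum.inr false :: r.x.tail := (List.cons_head?_tail hok.2).symm
      rw [List.length_append, hl, List.length_singleton] at hX hY
      -- The default entry is never reached, as the row has exactly `accs.length` entries.
      have hrow : (List.range accs.length).map (fun j => es.getD j (false, 0, 0)) = es := by
        refine List.ext_getElem (by simp [hes]) fun j h1 h2 => ?_
        simp [h2]
      have hcongr {β : Type} (f g : ℕ → List β) (hfg : ∀ i, accs.length < i → f i = g i) :
          (List.range' (accs.length + 1) k).flatMap f =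
            (List.range' (accs.length + 1) k).flatMap g :=
        List.flatMap_congr fun i hi => hfg i (by simp at hi; omega)
      -- The later rows only use indices above `accs.length`, so `C` and `e` can be overridden at
      -- that index.
      refine ⟨hok'.1, k + 1, Function.update C accs.length a,
        Function.update e accs.length fun j => es.getD j (false, 0, 0), by omega, ?_, ?_⟩
      · rw [List.range'_succ, List.flatMap_cons, hcongr _ (rowX C e) fun i hi => by
          simp [rowX, Function.update_of_ne hi.ne'], ← hX]
        simp only [rowX, Function.update_self, hrow]
        conv_lhs => rw [ha, hX', hrx]
        simp
      · rw [List.range'_succ, List.flatMap_cons, hcongr _ (rowY e) fun i hi => by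
          simp [rowY, Function.update_of_ne hi.ne'], List.append_assoc, ← hY]
        simp only [rowY, Function.update_self, hrow]
        exact hY'

/-- `key` evaluates the verifier on words already known to consist of rows; acceptance itself yields
this shape by `exists_rows_of_passRows`. -/
theorem verify_iff_rows (x y : List (Option Bool)) :
    verify x y = true ↔ ∃ (m : ℕ) (C : ℕ → ℕ) (e : ℕ → ℕ → Entry),
      x.map toSym = (List.range m).flatMap (rowX C e) ∧
      y.map toSym = (List.range m).flatMap (rowY e) ∧
      (∀ i < m, ∀ j < i, (e i j).valid = true) ∧ ∀ k < m, 1 ≤ balance C e m k := by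
  have key : ∀ (m : ℕ) (C : ℕ → ℕ) (e : ℕ → ℕ → Entry), m ≤ x.length →
      x.map toSym = (List.range m).flatMap (rowX C e) →
      y.map toSym = (List.range m).flatMap (rowY e) →
      (verify x y = true ↔
        (∀ i < m, ∀ j < i, (e i j).valid = true) ∧ ∀ k < m, 1 ≤ balance C e m k) := by
    intro m C e hm hx hy
    have h := passRows_rows C e m x.length 0 hm [] rfl rfl [] true
    simp only [← List.range_eq_range', List.append_nil, ← hx, ← hy, Bool.true_and,
      Nat.zero_add] at h
    obtain ⟨h1, h2, h3⟩ := h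
    have h4 : (passRows x.length (x.map toSym) (y.map toSym) [] true).accs.all accPos = true ↔
        ∀ k < m, 1 ≤ balance C e m k := by
      rw [List.all_eq_true]
      simp only [accPos_iff]
      rw [← List.forall_mem_map (P := fun v : ℤ => 1 ≤ v), h3]
      simp
    simp only [verify, h1, h2, Bool.and_eq_true, h4]
    simp
  constructor
  · intro h
    have h' := h
    simp only [verify, Bool.and_eq_true, List.isEmpty_iff] at h'
    obtain ⟨-, m, C, e, hm, hx, hy⟩ := exists_rows_of_passRows _ _ _ (by simp) _ _ h'.1.1
    rw [h'.1.2, List.append_nil] at hy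
    simp only [List.length_nil, ← List.range_eq_range'] at hx hy
    exact ⟨m, C, e, hx, hy, (key m C e hm hx hy).1 h⟩
  · rintro ⟨m, C, e, hx, hy, h⟩
    refine (key m C e ?_ hx hy).2 h
    -- Each row contains a separator, so `x.length` is large enough as a bound for the number of
    -- rows.
    have := congrArg List.length hx
    rw [List.length_map, List.length_flatMap] at this
    rw [this]
    calc m = ((List.range m).map fun _ => 1).sum := by simp
      _ ≤ _ := List.sum_le_sum fun i _ => by simp [rowX, numSyms]; omega

end CoverVerifier

/-! ### From rows indexed by `ℕ` to graphs on `Fin m` -/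

namespace CoverVerifier

theorem map_val_verticesBelow {m : ℕ} (i : Fin m) :
    (verticesBelow i).map Fin.val = List.range i := by
  have h : (verticesBelow i).map Fin.val = (List.range m).filter (fun j => decide (j < i.1)) := by
    rw [← List.map_coe_finRange_eq_range, List.filter_map]
    rfl
  rw [h]
  obtain ⟨k, hk⟩ := Nat.exists_eq_add_of_le i.2.le
  have h1 : List.range m = List.range i ++ (List.range k).map (i.1 + ·) := by
    conv_lhs => rw [hk]
    exact List.range_add
  rw [h1, List.filter_append, List.filter_eq_self.2 (by simp), List.filter_eq_nil_iff.2 (by simp),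
    List.append_nil]

theorem mem_verticesBelow {m : ℕ} {i j : Fin m} : j ∈ verticesBelow i ↔ j < i := by
  simp [verticesBelow]

theorem map_toSym_encodeInstance {m : ℕ} (G : SimpleGraph (Fin m)) (C : Fin m → ℕ)
    (C' : ℕ → ℕ) (e : ℕ → ℕ → Entry) (hC : ∀ i, C' i.1 = C i)
    (hG : ∀ i j : Fin m, j < i → ((e i j).1 = true ↔ G.Adj i j)) :
    (encodeInstance G C).map toSym = (List.range m).flatMap (rowX C' e) := by
  rw [encodeInstance, List.map_flatMap, ← List.map_coe_finRange_eq_range, List.flatMap_map]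
  refine List.flatMap_congr fun i _ => ?_
  rw [rowX, ← map_val_verticesBelow, hC]
  simp only [List.map_append, map_toSym_encodeNumber, List.map_map, List.append_assoc, entriesX,
    List.map_cons, List.map_nil]
  refine congrArg₂ _ rfl (congrArg₂ _ (List.map_congr_left fun j hj => ?_) rfl)
  have := hG i j (mem_verticesBelow.1 hj)
  simp only [Function.comp_apply, toSym, ← this, Bool.decide_eq_true]

theorem map_toSym_encodeMoves {m : ℕ} (n : Fin m → Fin m → ℕ) (e : ℕ → ℕ → Entry)
    (hn : ∀ i j : Fin m, j < i → (e i j).2 = (n i j, n j i)) :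
    (encodeMoves n).map toSym = (List.range m).flatMap (rowY e) := by
  rw [encodeMoves, List.map_flatMap, ← List.map_coe_finRange_eq_range, List.flatMap_map]
  refine List.flatMap_congr fun i _ => ?_
  rw [rowY, ← map_val_verticesBelow, entriesY, List.map_flatMap, List.flatMap_map,
    List.flatMap_map]
  refine List.flatMap_congr fun j hj => ?_
  simp [hn i j (mem_verticesBelow.1 hj), map_toSym_encodeNumber]

theorem balance_eq {m : ℕ} (C : Fin m → ℕ) (n : Fin m → Fin m → ℕ) (C' : ℕ → ℕ)
    (e : ℕ → ℕ → Entry) (hC : ∀ i, C' i.1 = C i) (hn : ∀ i j : Fin m, moves e i j = n i j)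
    (k : Fin m) :
    balance C' e m k = C k + ∑ l, (n l k : ℤ) - 2 * ∑ l, (n k l : ℤ) := by
  rw [balance, hC, ← List.map_coe_finRange_eq_range, List.map_map, ← Fin.sum_univ_def]
  simp only [Function.comp_apply, hn, Finset.sum_sub_distrib, Finset.mul_sum]
  ring

theorem verify_iff (x y : List (Option Bool)) :
    verify x y = true ↔ MoveCountCertificate x y := by
  classical
  rw [verify_iff_rows]
  constructor
  · rintro ⟨m, C, e, hx, hy, hvalid, hbal⟩
    -- The word only gives the bits below the diagonal; the graph is their symmetrisation.
    let G : SimpleGraph (Fin m) :=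
      { Adj := fun i j => (j < i ∧ (e i j).1 = true) ∨ (i < j ∧ (e j i).1 = true)
        symm := ⟨fun i j h => h.symm⟩
        loopless := ⟨fun i h => by simp at h⟩ }
    have hm (i j : Fin m) (hij : j < i) :
        (e i j).2 = (moves e i j, moves e j i) := by
      have h : j.1 < i.1 := hij
      simp [moves, h, h.not_gt]
    refine ⟨m, G, fun i => C i, fun i j => moves e i j, ?_, ?_, ?_, fun k => ?_⟩
    · refine List.map_injective_iff.2 toSym_injective (hx.trans ?_)
      refine (map_toSym_encodeInstance G _ C e (fun _ => rfl) fun i j hij => ?_).symm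
      simp [G, hij, hij.not_gt]
    · exact List.map_injective_iff.2 toSym_injective
        (hy.trans (map_toSym_encodeMoves _ e hm).symm)
    · intro i j hij
      rcases lt_trichotomy i j with h | h | h
      · have h' : i.1 < j.1 := h
        have := hvalid j j.2 i h
        have hadj : (e j i).1 = false := by simpa [G, h, h.not_gt] using hij
        simp only [Entry.valid, hadj, Bool.false_or, Bool.and_eq_true, beq_iff_eq] at this
        simp [moves, h', h'.not_gt, this.2]
      · simp [moves, h]
      · have h' : j.1 < i.1 := h
        have := hvalid i i.2 j h
        have hadj : (e i j).1 = false := by simpa [G, h, h.not_gt] using hij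
        simp only [Entry.valid, hadj, Bool.false_or, Bool.and_eq_true, beq_iff_eq] at this
        simp [moves, h', this.1]
    · rw [← balance_eq (fun i => C i) (fun i j => moves e i j) C e (fun _ => rfl)
        (fun _ _ => rfl) k]
      exact hbal k k.2
  · rintro ⟨m, G, C, n, rfl, rfl, hadj, hbal⟩
    -- The values outside `Fin m` are arbitrary, since only indices below `m` are inspected.
    let C' : ℕ → ℕ := fun i => if h : i < m then C ⟨i, h⟩ else 0
    let e : ℕ → ℕ → Entry := fun i j =>
      if h : i < m ∧ j < m then
        (decide (G.Adj ⟨i, h.1⟩ ⟨j, h.2⟩), n ⟨i, h.1⟩ ⟨j, h.2⟩, n ⟨j, h.2⟩ ⟨i, h.1⟩)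
      else (false, 0, 0)
    have hC (i : Fin m) : C' i.1 = C i := by simp [C']
    have he (i j : Fin m) : e i j = (decide (G.Adj i j), n i j, n j i) := by simp [e]
    have hm (i j : Fin m) : moves e i j = n i j := by
      simp only [moves, he]
      split_ifs with h1 h2
      · rfl
      · rfl
      · obtain rfl : i = j := Fin.ext (by omega)
        exact (hadj i i (G.loopless.irrefl i)).symm
    refine ⟨m, C', e, map_toSym_encodeInstance G C C' e hC fun i j _ => by simp [he],
      map_toSym_encodeMoves n e fun i j _ => by simp [he], fun i hi j hj => ?_, fun k hk => ?_⟩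
    · have h := he ⟨i, hi⟩ ⟨j, hj.trans hi⟩
      simp only at h
      rw [h]
      by_cases hG : G.Adj ⟨i, hi⟩ ⟨j, hj.trans hi⟩
      · simp [Entry.valid, hG]
      · simp [Entry.valid, hadj _ _ hG, hadj _ _ fun h => hG h.symm]
    · have h := balance_eq C n C' e hC hm ⟨k, hk⟩
      simp only at h
      rw [h]
      exact hbal ⟨k, hk⟩

end CoverVerifier

/-! ### The verifier as a program -/

namespace CoverVerifier

open StackProgram

/-- The working stacks: `X` and `Y` hold the unread parts of the two words, `A` the accumulators
to be updated, `B` the updated ones, `D` the accumulator of the current vertex; the others are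
auxiliary. -/
inductive Work
  | X | Y | A | B | D | E | P | T | U | V
  deriving DecidableEq

instance : Fintype Work where
  elems := {Work.X, Work.Y, Work.A, Work.B, Work.D, Work.E, Work.P, Work.T, Work.U, Work.V}
  complete := by rintro ⟨⟩ <;> decide

/-- All stacks. -/
inductive Stack
  | inp
  | out
  | work (k : Work)
  deriving DecidableEq

instance : Fintype Stack where
  elems := insert Stack.inp (insert Stack.out (Finset.univ.image Stack.work))
  complete := by rintro (_ | _ | k) <;> simp

/-- The letters of the encoding of a pair of words. -/
abbrev InLetter := Option (Option Bool ⊕ Option Bool)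

/-- The alphabets of the stacks. -/
@[reducible]
def Alphabet : Stack → Type
  | Stack.inp => InLetter
  | Stack.out => Bool
  | Stack.work _ => Sym

/-- The register of the machine. -/
structure Reg where
  ok : Bool
  cur : Option Sym := none
  edge : Option Sym := none
  p : Option Sym := none
  d : Option Sym := none
  u : Option Sym := none
  v : Option Sym := none
  c₁ : Carry := zeroCarry
  c₂ : Carry := zeroCarry
  seen : Bool := false

instance : Finite Reg :=
  Finite.of_injective
    (fun r : Reg => (r.ok, r.cur, r.edge, r.p, r.d, r.u, r.v, r.c₁, r.c₂, r.seen)) (by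
      rintro ⟨⟩ ⟨⟩ h
      simpa using h)

/-- The contents of all contents, given those of the input, the output and the working stacks. -/
def contents (i : List InLetter) (o : List Bool) (w : Work → List Sym) :
    ∀ k, List (Alphabet k)
  | Stack.inp => i
  | Stack.out => o
  | Stack.work k => w k

@[simp]
theorem contents_inp (i : List InLetter) (o : List Bool) (w : Work → List Sym) :
    contents i o w Stack.inp = i := rfl

@[simp]
theorem contents_out (i : List InLetter) (o : List Bool) (w : Work → List Sym) :
    contents i o w Stack.out = o := rfl

@[simp]
theorem contents_work (i : List InLetter) (o : List Bool) (w : Work → List Sym) (k : Work) :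
    contents i o w (Stack.work k) = w k := rfl

@[simp]
theorem update_contents_inp (i i' : List InLetter) (o : List Bool) (w : Work → List Sym) :
    Function.update (contents i o w) Stack.inp i' = contents i' o w := by
  funext k
  cases k <;> simp [Function.update, contents]

@[simp]
theorem update_contents_out (i : List InLetter) (o o' : List Bool) (w : Work → List Sym) :
    Function.update (contents i o w) Stack.out o' = contents i o' w := by
  funext k
  cases k <;> simp [Function.update, contents]

@[simp]
theorem update_contents_work (i : List InLetter) (o : List Bool) (w : Work → List Sym) (k : Work)
    (l : List Sym) :
    Function.update (contents i o w) (Stack.work k) l = contents i o (Function.update w k l) := by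
  funext k'
  cases k' with
  | inp => simp [Function.update, contents]
  | out => simp [Function.update, contents]
  | work k' =>
    by_cases h : k' = k
    · subst h
      simp
    · simp [h]

/-- The contents of the working stacks. -/
def mem (x y a b d e p t u v : List Sym) : Work → List Sym
  | Work.X => x
  | Work.Y => y
  | Work.A => a
  | Work.B => b
  | Work.D => d
  | Work.E => e
  | Work.P => p
  | Work.T => t
  | Work.U => u
  | Work.V => v

section mem

variable (x y a b d e p t u v l : List Sym)

/-- Brings stack contents back to the ten-argument form, in which states can be compared by `simp`.
-/
theorem update_mem :
    Function.update (mem x y a b d e p t u v) Work.X l = mem l y a b d e p t u v ∧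
    Function.update (mem x y a b d e p t u v) Work.Y l = mem x l a b d e p t u v ∧
    Function.update (mem x y a b d e p t u v) Work.A l = mem x y l b d e p t u v ∧
    Function.update (mem x y a b d e p t u v) Work.B l = mem x y a l d e p t u v ∧
    Function.update (mem x y a b d e p t u v) Work.D l = mem x y a b l e p t u v ∧
    Function.update (mem x y a b d e p t u v) Work.E l = mem x y a b d l p t u v ∧
    Function.update (mem x y a b d e p t u v) Work.P l = mem x y a b d e l t u v ∧
    Function.update (mem x y a b d e p t u v) Work.T l = mem x y a b d e p l u v ∧
    Function.update (mem x y a b d e p t u v) Work.U l = mem x y a b d e p t l v ∧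
    Function.update (mem x y a b d e p t u v) Work.V l = mem x y a b d e p t u l := by
  refine ⟨?_, ?_, ?_, ?_, ?_, ?_, ?_, ?_, ?_, ?_⟩ <;> funext k <;> cases k <;> rfl

end mem

/-! ### Elementary programs: moving stacks and reading numbers -/

/-- Programs of the verifier. -/
abbrev VProg := Prog Alphabet Reg

/-- Popping a symbol into the register. -/
def popCur (k : Work) : Act Alphabet Reg :=
  Act.pop (Stack.work k) fun v s => { v with cur := s }

/-- Pushing the symbol in the register. -/
def pushCur (k : Work) : Act Alphabet Reg :=
  Act.push (Stack.work k) fun v => v.cur.getD (Sum.inr false)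

/-- Moving a stack onto another one. -/
def move (src dst : Work) : VProg :=
  Prog.loop [popCur src] (fun v => v.cur.isSome) (Prog.block [pushCur dst])

/-- Moving a stack up to the first separator onto another one. -/
def readTo (src dst : Work) : VProg :=
  Prog.loop [popCur src] (fun v => isBit v.cur) (Prog.block [pushCur dst])

variable {i : List InLetter} {o : List Bool}

theorem update_update_self {k k' : Work} (hk : k ≠ k') (w : Work → List Sym) (l : List Sym) :
    Function.update (Function.update w k l) k' (w k') = Function.update w k l := by
  simp [hk.symm]

theorem update_update_update_update {k k' : Work} (hk : k ≠ k') (w : Work → List Sym)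
    (l₁ l₂ l₃ l₄ : List Sym) :
    Function.update (Function.update (Function.update (Function.update w k l₁) k' l₂) k l₃) k' l₄ =
      Function.update (Function.update w k l₃) k' l₄ := by
  rw [Function.update_comm hk.symm, Function.update_idem, Function.update_idem]

/-- Each symbol costs a test and a body, and the failing test one more step. Moving reverses the
order. -/
theorem runs_move {k k' : Work} (hk : k ≠ k') (r : Reg) (w : Work → List Sym) :
    Runs (move k k') (r, contents i o w) ({ r with cur := none },
      contents i o (Function.update (Function.update w k []) k' ((w k).reverse ++ w k')))
      (2 * (w k).length + 1) := by
  induction hl : w k generalizing r w with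
  | nil =>
    refine Runs.loop_exit_eq ?_ rfl le_rfl
    simp [runBlock, Act.run, popCur, hl, update_update_self hk]
  | cons s l ih =>
    have h := ih { r with cur := some s }
      (Function.update (Function.update w k l) k' (s :: w k')) (by simp [hk])
    rw [update_update_update_update hk, Function.update_self] at h
    refine Runs.loop_step_eq
      (s₀ := ({ r with cur := some s }, contents i o (Function.update w k l)))
      ?_ rfl (Runs.block_eq ?_ le_rfl) (by simpa [move] using h) (by simp; omega)
    · simp [runBlock, Act.run, popCur, hl]
    · simp [runBlock, Act.run, pushCur, hk.symm]

/-- The separator is popped but not pushed; it stays in the register for inspection. -/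
theorem runs_readTo {k k' : Work} (hk : k ≠ k') (r : Reg) (w : Work → List Sym) :
    Runs (readTo k k') (r, contents i o w) ({ r with cur := (readBlock (w k)).terminal },
      contents i o (Function.update (Function.update w k (readBlock (w k)).rest) k'
        ((readBlock (w k)).syms.reverse ++ w k')))
      (2 * (w k).length + 1) := by
  induction hl : w k generalizing r w with
  | nil =>
    refine Runs.loop_exit_eq ?_ rfl le_rfl
    simp [runBlock, Act.run, popCur, hl, readBlock, Block.syms, update_update_self hk]
  | cons s l ih =>
    cases s with
    | inr s =>
      refine Runs.loop_exit_eq ?_ rfl (by simp)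
      simp [runBlock, Act.run, popCur, hl, readBlock, Block.syms, update_update_self hk]
    | inl s =>
      have h := ih { r with cur := some (Sum.inl s) }
        (Function.update (Function.update w k l) k' (Sum.inl s :: w k')) (by simp [hk])
      rw [update_update_update_update hk, Function.update_self] at h
      refine Runs.loop_step_eq
        (s₀ := ({ r with cur := some (Sum.inl s) }, contents i o (Function.update w k l)))
        ?_ rfl (Runs.block_eq ?_ le_rfl) (by simpa [readTo, readBlock, Block.syms] using h)
        (by simp; omega)
      · simp [runBlock, Act.run, popCur, hl]
      · simp [runBlock, Act.run, pushCur, hk.symm]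

/-- Checking that the block whose bits are on `T` is the binary representation of a number. -/
def checkNumber : Act Alphabet Reg :=
  Act.peek (Stack.work Work.T) fun v s =>
    { v with
      ok := v.ok && (decide (v.cur = some (Sum.inr false)) && decide (s ≠ some (Sum.inl false)))
      cur := none }

/-- Reading the bits of a number. -/
def readNumber (src dst : Work) : VProg :=
  Prog.seq (readTo src Work.T) (Prog.seq (Prog.block [checkNumber]) (move Work.T dst))

/-- The detour over `T` reverses the bits twice. In between, the leading bit is on top, so a single
peek tests that the number is canonical. -/
theorem runs_readNumber {k k' : Work} (hk : k ≠ k') (hT : k ≠ Work.T) (hT' : Work.T ≠ k')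
    (r : Reg) (w : Work → List Sym) (hw : w Work.T = []) :
    Runs (readNumber k k') (r, contents i o w)
      ({ r with ok := r.ok && (readBlock (w k)).isNumber, cur := none },
        contents i o (Function.update (Function.update w k (readBlock (w k)).rest) k'
          ((readBlock (w k)).syms ++ w k')))
      (4 * (w k).length + 3) := by
  have h₂ := runs_move (i := i) (o := o) hT'
    { r with ok := r.ok && (readBlock (w k)).isNumber, cur := none }
    (Function.update (Function.update w k (readBlock (w k)).rest) Work.T
      ((readBlock (w k)).syms.reverse ++ w Work.T))
  have hmem : Function.update (Function.update (Function.update (Function.update w k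
      (readBlock (w k)).rest) Work.T (readBlock (w k)).syms.reverse) Work.T []) k'
        ((readBlock (w k)).syms ++ w k') =
      Function.update (Function.update w k (readBlock (w k)).rest) k'
        ((readBlock (w k)).syms ++ w k') := by
    rw [Function.update_idem, ← hw, update_update_self hT]
  rw [hw, List.append_nil, Function.update_self, List.reverse_reverse,
    Function.update_of_ne hT'.symm, Function.update_of_ne hk.symm, hmem] at h₂
  have hlen := length_readBlock_rest (w k)
  refine Runs.seq (runs_readTo hT r w) (Runs.seq (Runs.block_eq ?_ le_rfl) h₂ le_rfl) ?_
  · simp [runBlock, Act.run, checkNumber, hw, Block.syms, Block.isNumber]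
  · simp only [Block.syms, List.length_map, List.length_reverse]
    omega

end CoverVerifier

/-! ### Programs for additions, entries and rows -/

namespace CoverVerifier

open StackProgram

variable {i : List InLetter} {o : List Bool}

/-- The loop of the simultaneous addition of `u - 2 v` and `v - 2 u` to two accumulators. -/
def sumLoop : VProg :=
  Prog.loop
    [Act.pop (Stack.work Work.P) fun r s => { r with p := s },
      Act.pop (Stack.work Work.D) fun r s => { r with d := s },
      Act.pop (Stack.work Work.U) fun r s => { r with u := s },
      Act.pop (Stack.work Work.V) fun r s => { r with v := s }]
    (fun r => (r.p.isSome || r.d.isSome) || (r.u.isSome || r.v.isSome))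
    (Prog.block
      [Act.push (Stack.work Work.B) fun r => Sum.inl (outBit r.c₁ r.p r.u r.v),
        Act.push (Stack.work Work.E) fun r => Sum.inl (outBit r.c₂ r.d r.v r.u),
        Act.load fun r =>
          { r with c₁ := nextCarry r.c₁ r.p r.u r.v, c₂ := nextCarry r.c₂ r.d r.v r.u }])

/-- Both additions consume the same copies of `u` and `v`, so they share one loop, which ends when
all four stacks are empty. This is why `passWidth` is a maximum of four lengths. -/
theorem runs_sumLoop (n : ℕ) (ok : Bool) (c₁ c₂ : Carry) (p₀ d₀ u₀ v₀ : Option Sym)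
    (x y a b d e p t u v : List Sym)
    (hn : max (max p.length d.length) (max u.length v.length) = n) :
    Runs sumLoop
      ({ ok := ok, c₁ := c₁, c₂ := c₂, p := p₀, d := d₀, u := u₀, v := v₀ },
        contents i o (mem x y a b d e p t u v))
      ({ ok := ok, c₁ := (sumBits n c₁ p u v).2, c₂ := (sumBits n c₂ d v u).2 },
        contents i o (mem x y a (((sumBits n c₁ p u v).1.map Sum.inl).reverse ++ b) []
          (((sumBits n c₂ d v u).1.map Sum.inl).reverse ++ e) [] t [] []))
      (2 * n + 1) := by
  induction n generalizing c₁ c₂ p₀ d₀ u₀ v₀ b d e p u v with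
  | zero =>
    obtain ⟨rfl, rfl, rfl, rfl⟩ : p = [] ∧ d = [] ∧ u = [] ∧ v = [] := by
      simpa [Nat.max_eq_zero_iff] using hn
    refine Runs.loop_exit_eq ?_ rfl le_rfl
    simp [runBlock, Act.run, update_mem, mem, sumBits]
  | succ n ih =>
    have h := ih (nextCarry c₁ p.head? u.head? v.head?) (nextCarry c₂ d.head? v.head? u.head?)
      p.head? d.head? u.head? v.head? (Sum.inl (outBit c₁ p.head? u.head? v.head?) :: b) d.tail
      (Sum.inl (outBit c₂ d.head? v.head? u.head?) :: e) p.tail u.tail v.tail (by simp; omega)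
    refine Runs.loop_step_eq
      (s₀ := (
        { ok := ok, c₁ := c₁, c₂ := c₂, p := p.head?, d := d.head?, u := u.head?, v := v.head? },
        contents i o (mem x y a b d.tail e p.tail t u.tail v.tail)))
      ?_ ?_ (Runs.block_eq ?_ le_rfl) (by simpa [sumBits, sumLoop] using h) (by omega)
    · simp [runBlock, Act.run, update_mem, mem]
    · by_contra hc
      simp only [Bool.or_eq_true, Option.isSome_iff_ne_none, not_or, not_not,
        List.head?_eq_none_iff] at hc
      obtain ⟨⟨rfl, rfl⟩, rfl, rfl⟩ := hc
      simp at hn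
    · simp [runBlock, Act.run, update_mem, mem]

/-- The end of the addition, where the remaining carries are written. -/
def sumEnd : VProg :=
  Prog.block
    [Act.push (Stack.work Work.B) fun r => Sum.inl (carryBit₀ r.c₁),
      Act.push (Stack.work Work.B) fun r => Sum.inl (carryBit₁ r.c₁),
      Act.push (Stack.work Work.B) fun r => Sum.inr (carrySign r.c₁),
      Act.push (Stack.work Work.E) fun r => Sum.inl (carryBit₀ r.c₂),
      Act.push (Stack.work Work.E) fun r => Sum.inl (carryBit₁ r.c₂),
      Act.push (Stack.work Work.E) fun r => Sum.inr (carrySign r.c₂),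
      Act.load fun r => { r with c₁ := zeroCarry, c₂ := zeroCarry }]

/-- The addition of `u - 2 v` and `v - 2 u` to two accumulators. -/
def sumProg : VProg :=
  Prog.seq sumLoop (Prog.seq sumEnd (move Work.E Work.D))

theorem runs_sumProg (n : ℕ) (ok : Bool) (x y a b d p u v : List Sym)
    (hn : max (max p.length d.length) (max u.length v.length) = n) :
    Runs sumProg ({ ok := ok }, contents i o (mem x y a b d [] p [] u v))
      ({ ok := ok }, contents i o (mem x y a ((accSyms (addAcc n p u v)).reverse ++ b)
        (accSyms (addAcc n d v u)) [] [] [] [] []))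
      (4 * n + 9) := by
  have h₁ := runs_sumLoop (i := i) (o := o) n ok zeroCarry zeroCarry none none none none
    x y a b d [] p [] u v hn
  have h₂ := runs_move (i := i) (o := o) (k := Work.E) (k' := Work.D) (by decide) { ok := ok }
    (mem x y a ((accSyms (addAcc n p u v)).reverse ++ b) []
      (accSyms (addAcc n d v u)).reverse [] [] [] [])
  simp only [update_mem, mem, List.reverse_reverse, List.append_nil] at h₂
  refine Runs.seq h₁ (Runs.seq (Runs.block_eq ?_ le_rfl) h₂ le_rfl) ?_
  · simp [runBlock, Act.run, update_mem, mem, accSyms, addAcc]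
  · rw [List.length_reverse, length_accSyms_addAcc]
    omega

/-- Loading the next accumulator onto `P`. -/
def loadAcc : VProg :=
  Prog.seq (readTo Work.A Work.T) (Prog.seq (Prog.block [pushCur Work.T]) (move Work.T Work.P))

/-- The separator kept by `readTo` is the sign of the accumulator, so it is pushed back before the
reversal. -/
theorem runs_loadAcc (ok : Bool) (x y : List Sym) (a : Acc) (l b d e u v : List Sym) :
    Runs loadAcc ({ ok := ok }, contents i o (mem x y (accSyms a ++ l) b d e [] [] u v))
      ({ ok := ok }, contents i o (mem x y l b d e (accSyms a) [] u v))
      (2 * (accSyms a ++ l).length + 2 * (accSyms a).length + 3) := by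
  have h₁ := runs_readTo (i := i) (o := o) (k := Work.A) (k' := Work.T) (by decide) { ok := ok }
    (mem x y (accSyms a ++ l) b d e [] [] u v)
  simp only [update_mem, mem, readBlock_accSyms_append, List.append_nil] at h₁
  have h₂ := runs_move (i := i) (o := o) (k := Work.T) (k' := Work.P) (by decide)
    { ok := ok, cur := some (Sum.inr a.2) } (mem x y l b d e [] (accSyms a).reverse u v)
  simp only [update_mem, mem, List.reverse_reverse, List.append_nil] at h₂
  refine Runs.seq h₁ (Runs.seq (Runs.block_eq ?_ le_rfl) h₂ le_rfl) ?_
  · simp [runBlock, Act.run, pushCur, update_mem, mem, accSyms, Block.syms]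
  · rw [List.length_reverse]
    omega

/-- Checking that moves are counted on edges only. -/
def checkEdge : VProg :=
  Prog.block
    [Act.peek (Stack.work Work.U) fun r s => { r with u := s },
      Act.peek (Stack.work Work.V) fun r s => { r with v := s },
      Act.load fun r =>
        { r with
          ok := r.ok && (isBit r.edge && (isOne r.edge || (r.u.isNone && r.v.isNone)))
          edge := none
          u := none
          v := none }]

/-- Processing one entry of a row. -/
def entryProg : VProg :=
  Prog.seq (Prog.block [Act.pop (Stack.work Work.X) fun r s => { r with edge := s }])
    (Prog.seq (readNumber Work.Y Work.U)
      (Prog.seq (readNumber Work.Y Work.V)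
        (Prog.seq checkEdge (Prog.seq loadAcc sumProg))))

theorem runs_entryProg (ok : Bool) (c : Option Sym) (x y : List Sym) (a d : Acc)
    (l b : List Sym) (u v : Block) (hu : readBlock y = u) (hv : readBlock u.rest = v) :
    Runs entryProg
      ({ ok := ok, cur := c }, contents i o (mem x y (accSyms a ++ l) b (accSyms d) [] [] [] [] []))
      ({ ok := ok && entryOk x.head? u v },
        contents i o (mem x.tail v.rest l
          ((accSyms (addAcc (passWidth a d u v) (accSyms a) u.syms v.syms)).reverse ++ b)
          (accSyms (addAcc (passWidth a d u v) (accSyms d) v.syms u.syms)) [] [] [] [] []))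
      (8 * y.length + 2 * (accSyms a ++ l).length + 2 * (accSyms a).length +
        4 * passWidth a d u v + 20) := by
  have h₁ := runs_readNumber (i := i) (o := o) (k := Work.Y) (k' := Work.U) (by decide) (by decide)
    (by decide) { ok := ok, cur := c, edge := x.head? }
    (mem x.tail y (accSyms a ++ l) b (accSyms d) [] [] [] [] []) rfl
  simp only [update_mem, mem, hu, List.append_nil] at h₁
  have h₂ := runs_readNumber (i := i) (o := o) (k := Work.Y) (k' := Work.V) (by decide) (by decide)
    (by decide) { ok := ok && u.isNumber, edge := x.head? }
    (mem x.tail u.rest (accSyms a ++ l) b (accSyms d) [] [] [] u.syms []) rfl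
  simp only [update_mem, mem, hv, List.append_nil] at h₂
  have h₃ := runs_loadAcc (i := i) (o := o) (ok && entryOk x.head? u v) x.tail v.rest a l b
    (accSyms d) [] u.syms v.syms
  have h₄ := runs_sumProg (i := i) (o := o) (passWidth a d u v) (ok && entryOk x.head? u v)
    x.tail v.rest l b (accSyms d) (accSyms a) u.syms v.syms rfl
  have hlen : u.rest.length ≤ y.length := by
    have := length_readBlock_rest y
    rw [hu] at this
    omega
  refine Runs.seq (Runs.block_eq ?_ le_rfl) (Runs.seq h₁ (Runs.seq h₂ (Runs.seq
    (Runs.block_eq ?_ le_rfl) (Runs.seq h₃ h₄ le_rfl) le_rfl) le_rfl) le_rfl) ?_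
  · simp [runBlock, Act.run, update_mem, mem]
  · have hh (l : List Bool) : (l.map (Sum.inl : Bool → Sym)).head?.isNone = l.isEmpty := by
      cases l <;> rfl
    simp only [runBlock, Act.run, mem, contents_work, entryOk, Block.syms, hh]
    congr 2
    -- The program makes the checks in another order than `entryOk`.
    cases ok <;> cases isBit x.head? <;> cases u.isNumber <;> cases v.isNumber <;> rfl
  · omega

/-- Processing the entries of a row. -/
def rowLoop : VProg :=
  Prog.loop [Act.peek (Stack.work Work.A) fun r s => { r with cur := s }]
    (fun r => r.cur.isSome) entryProg

theorem length_flatMap_accSyms_le {M : ℕ} {accs : List Acc}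
    (h : ∀ a ∈ accs, (accSyms a).length ≤ M) :
    (accs.flatMap accSyms).length ≤ accs.length * M := by
  rw [List.length_flatMap]
  refine (List.sum_le_card_nsmul _ M ?_).trans (by simp)
  intro m hm
  obtain ⟨a, ha, rfl⟩ := List.mem_map.1 hm
  exact h a ha

theorem passWidth_le {M : ℕ} {a d : Acc} {y : List Sym} {u v : Block} (hu : readBlock y = u)
    (hv : readBlock u.rest = v) (ha : (accSyms a).length ≤ M) (hd : (accSyms d).length ≤ M)
    (hy : y.length ≤ M) : passWidth a d u v ≤ M ∧ v.rest.length ≤ M := by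
  have h₁ := length_readBlock_rest y
  have h₂ := length_readBlock_rest u.rest
  rw [hu] at h₁
  rw [hv] at h₂
  simp only [passWidth, Block.syms, List.length_map]
  omega

/-- The accumulator `d` takes part in every addition of the row and may grow by three symbols each
time; the others are added to once, at the width reached by then. -/
theorem length_passRow_le {M : ℕ} (accs : List Acc) (x y : List Sym) (d : Acc) (ok : Bool)
    (ha : ∀ a ∈ accs, (accSyms a).length ≤ M) (hd : (accSyms d).length ≤ M)
    (hy : y.length ≤ M) :
    (∀ a ∈ (passRow accs x y d ok).accs, (accSyms a).length ≤ M + 3 * accs.length) ∧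
      (accSyms (passRow accs x y d ok).d).length ≤ M + 3 * accs.length ∧
      (passRow accs x y d ok).y.length ≤ y.length := by
  induction accs generalizing M x y d ok with
  | nil => exact ⟨by simp [passRow], by simpa [passRow] using hd, le_rfl⟩
  | cons a l ih =>
    have hw := passWidth_le rfl rfl (ha a (by simp)) hd hy
    have hr₁ := length_readBlock_rest y
    have hr₂ := length_readBlock_rest (readBlock y).rest
    simp only [passRow]
    obtain ⟨h₁, h₂, h₃⟩ := ih (M := M + 3) x.tail (readBlock (readBlock y).rest).rest
      (addAcc (passWidth a d (readBlock y) (readBlock (readBlock y).rest)) (accSyms d)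
        (readBlock (readBlock y).rest).syms (readBlock y).syms)
      (ok && entryOk x.head? (readBlock y) (readBlock (readBlock y).rest))
      (fun a' ha' => (ha a' (by simp [ha'])).trans (by omega))
      (by rw [length_accSyms_addAcc]; omega) (by omega)
    refine ⟨?_, ?_, h₃.trans (by omega)⟩
    · intro a' ha'
      rcases List.mem_cons.1 ha' with rfl | ha'
      · rw [length_accSyms_addAcc, List.length_cons]
        omega
      · have := h₁ a' ha'
        rw [List.length_cons]
        omega
    · rw [List.length_cons]
      omega

/-- `M` is one width for the whole row: the slack of three symbols per remaining accumulator is used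
up as `d` grows. The term `N * M` bounds the stack `A`. -/
theorem runs_rowLoop {M N : ℕ} (accs : List Acc) (x y : List Sym) (d : Acc) (ok : Bool)
    (b : List Sym) (ha : ∀ a ∈ accs, (accSyms a).length + 3 * accs.length ≤ M)
    (hd : (accSyms d).length + 3 * accs.length ≤ M) (hy : y.length + 3 * accs.length ≤ M)
    (hN : accs.length ≤ N) :
    Runs rowLoop
      ({ ok := ok }, contents i o (mem x y (accs.flatMap accSyms) b (accSyms d) [] [] [] [] []))
      ({ ok := (passRow accs x y d ok).ok },
        contents i o (mem (passRow accs x y d ok).x (passRow accs x y d ok).y []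
          (((passRow accs x y d ok).accs.flatMap accSyms).reverse ++ b)
          (accSyms (passRow accs x y d ok).d) [] [] [] [] []))
      (accs.length * (14 * M + 2 * (N * M) + 21) + 1) := by
  induction accs generalizing x y d ok b with
  | nil =>
    refine Runs.loop_exit_eq ?_ rfl (by simp)
    simp [runBlock, Act.run, mem, passRow]
  | cons a l ih =>
    have hlen : ((a :: l).flatMap accSyms).length ≤ N * M :=
      (length_flatMap_accSyms_le fun a' ha' => (Nat.le_add_right _ _).trans (ha a' ha')).trans
        (Nat.mul_le_mul_right M hN)
    rw [List.flatMap_cons] at hlen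
    simp only [List.length_cons] at ha hd hy hN
    have haM := ha a (by simp)
    obtain ⟨hw, hv⟩ := passWidth_le (M := M - 3 * (l.length + 1)) (y := y) rfl rfl
      (a := a) (d := d) (by omega) (by omega) (by omega)
    have h₁ := runs_entryProg (i := i) (o := o) ok (accSyms a ++ l.flatMap accSyms).head? x y a d
      (l.flatMap accSyms) b _ _ rfl rfl
    have h₂ := ih x.tail (readBlock (readBlock y).rest).rest
      (addAcc (passWidth a d (readBlock y) (readBlock (readBlock y).rest)) (accSyms d)
        (readBlock (readBlock y).rest).syms (readBlock y).syms)
      (ok && entryOk x.head? (readBlock y) (readBlock (readBlock y).rest))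
      ((accSyms (addAcc (passWidth a d (readBlock y) (readBlock (readBlock y).rest)) (accSyms a)
        (readBlock y).syms (readBlock (readBlock y).rest).syms)).reverse ++ b)
      (fun a' ha' => by have := ha a' (by simp [ha']); omega)
      (by rw [length_accSyms_addAcc]; omega) (by omega) (by omega)
    refine Runs.loop_step_eq ?_ ?_ h₁ (by simpa [passRow, rowLoop] using h₂) ?_
    · simp [runBlock, Act.run, mem]
    · simp [accSyms]
    · rw [List.length_cons, Nat.add_mul]
      omega

/-- Processing a row. -/
def rowProg : VProg :=
  Prog.seq (Prog.block [Act.push (Stack.work Work.D) fun _ => Sum.inr false])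
    (Prog.seq (readNumber Work.X Work.D)
      (Prog.seq rowLoop
        (Prog.seq
          (Prog.block [Act.pop (Stack.work Work.X) fun r s =>
            { r with ok := r.ok && decide (s = some (Sum.inr false)) }])
          (Prog.seq (move Work.D Work.B) (move Work.B Work.A)))))

/-- The separator pushed first onto `D` is the sign of the pebble number. At the end `D` is put on
the reversed accumulators in `B`, so that one more reversal makes the new accumulator the last on
`A`. -/
theorem runs_rowProg {M N : ℕ} (c : Option Sym) (accs : List Acc) (x y : List Sym) (ok : Bool)
    (ha : ∀ a ∈ accs, (accSyms a).length + 3 * accs.length ≤ M)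
    (hx : x.length + 1 + 3 * accs.length ≤ M) (hy : y.length + 3 * accs.length ≤ M)
    (hN : accs.length ≤ N) (r : Pass)
    (hr : passRow accs (readBlock x).rest y ((readBlock x).bits, false)
      (ok && (readBlock x).isNumber) = r) :
    Runs rowProg
      ({ ok := ok, cur := c }, contents i o (mem x y (accs.flatMap accSyms) [] [] [] [] [] [] []))
      ({ ok := r.ok && decide (r.x.head? = some (Sum.inr false)) },
        contents i o (mem r.x.tail r.y ((r.accs ++ [r.d]).flatMap accSyms) [] [] [] [] [] [] []))
      (N * (14 * M + 2 * (N * M) + 21) + 2 * (N * M) + 8 * M + 10) := by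
  have hlx := length_readBlock_rest x
  have hd : (accSyms ((readBlock x).bits, false)).length = (readBlock x).bits.length + 1 := by
    simp [accSyms]
  have h₁ := runs_readNumber (i := i) (o := o) (k := Work.X) (k' := Work.D) (by decide) (by decide)
    (by decide) { ok := ok, cur := c }
    (mem x y (accs.flatMap accSyms) [] [Sum.inr false] [] [] [] [] []) rfl
  simp only [update_mem, mem] at h₁
  have h₂ := runs_rowLoop (i := i) (o := o) accs (readBlock x).rest y ((readBlock x).bits, false)
    (ok && (readBlock x).isNumber) [] ha (by omega) hy hN
  obtain ⟨hw₁, hw₂, -⟩ := length_passRow_le (M := M - 3 * accs.length) accs (readBlock x).rest y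
    ((readBlock x).bits, false) (ok && (readBlock x).isNumber)
    (fun a h => by have := ha a h; omega) (by omega) (by omega)
  have hl := length_passRow_accs accs (readBlock x).rest y ((readBlock x).bits, false)
    (ok && (readBlock x).isNumber)
  rw [hr] at h₂ hw₁ hw₂ hl
  have hlen : (r.accs.flatMap accSyms).length ≤ N * M :=
    (length_flatMap_accSyms_le fun a h => by have := hw₁ a h; omega).trans
      (Nat.mul_le_mul_right M (hl.trans_le hN))
  rw [List.append_nil] at h₂
  have h₃ := runs_move (i := i) (o := o) (k := Work.D) (k' := Work.B) (by decide)
    { ok := r.ok && decide (r.x.head? = some (Sum.inr false)) }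
    (mem r.x.tail r.y [] (r.accs.flatMap accSyms).reverse (accSyms r.d) [] [] [] [] [])
  simp only [update_mem, mem] at h₃
  have h₄ := runs_move (i := i) (o := o) (k := Work.B) (k' := Work.A) (by decide)
    { ok := r.ok && decide (r.x.head? = some (Sum.inr false)) }
    (mem r.x.tail r.y [] ((accSyms r.d).reverse ++ (r.accs.flatMap accSyms).reverse) []
      [] [] [] [] [])
  simp only [update_mem, mem] at h₄
  have hA : ((accSyms r.d).reverse ++ (r.accs.flatMap accSyms).reverse).reverse ++ [] =
      (r.accs ++ [r.d]).flatMap accSyms := by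
    simp
  rw [hA] at h₄
  refine Runs.seq (Runs.block_eq ?_ le_rfl) (Runs.seq h₁ (Runs.seq h₂ (Runs.seq
    (Runs.block_eq ?_ le_rfl) (Runs.seq h₃ h₄ le_rfl) le_rfl) le_rfl) le_rfl) ?_
  · simp [runBlock, Act.run, update_mem, mem]
  · simp only [runBlock, Act.run, update_mem, mem, contents_work, update_contents_work]
    rfl
  · have := Nat.mul_le_mul_right (14 * M + 2 * (N * M) + 21) hN
    simp only [List.length_append, List.length_reverse]
    omega

/-- Processing all rows. -/
def rowsLoop : VProg :=
  Prog.loop [Act.peek (Stack.work Work.X) fun r s => { r with cur := s }]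
    (fun r => r.cur.isSome) rowProg

/-- `L` bounds the current widths and grows by `3 * N` per row; `hM` reserves room for the remaining
rows within the fixed `M`. The size bounds are proved along with the run because the final scan
needs them. -/
theorem runs_rowsLoop {L M N : ℕ} (n : ℕ) (x y : List Sym) (accs : List Acc) (ok : Bool)
    (hx : x.length ≤ n) (hN : accs.length + n ≤ N) (hxL : x.length + 1 ≤ L) (hyL : y.length ≤ L)
    (haL : ∀ a ∈ accs, (accSyms a).length ≤ L) (hM : L + 3 * N * n ≤ M) :
    Runs rowsLoop
      ({ ok := ok }, contents i o (mem x y (accs.flatMap accSyms) [] [] [] [] [] [] []))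
      ({ ok := (passRows n x y accs ok).ok },
        contents i o (mem [] (passRows n x y accs ok).y
          ((passRows n x y accs ok).accs.flatMap accSyms) [] [] [] [] [] [] []))
      (n * (N * (14 * M + 2 * (N * M) + 21) + 2 * (N * M) + 8 * M + 11) + 1) ∧
    (passRows n x y accs ok).y.length ≤ M ∧
    (passRows n x y accs ok).accs.length ≤ N ∧
    ∀ a ∈ (passRows n x y accs ok).accs, (accSyms a).length ≤ M := by
  induction n generalizing L x y accs ok with
  | zero =>
    obtain rfl : x = [] := by simpa using hx
    refine ⟨Runs.loop_exit_eq ?_ rfl (by simp), ?_, ?_, ?_⟩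
    · simp [runBlock, Act.run, mem, passRows]
    · simp only [passRows]; omega
    · simp only [passRows]; omega
    · intro a h
      exact (haL a h).trans (by omega)
  | succ n ih =>
    by_cases hne : x = []
    · subst hne
      simp only [passRows, if_true]
      have hL : L ≤ M := by omega
      refine ⟨Runs.loop_exit_eq ?_ rfl (by simp), by omega, by omega,
        fun a h => (haL a h).trans hL⟩
      simp [runBlock, Act.run, mem]
    · simp only [passRows, if_neg hne]
      have hM' : L + 3 * N + 3 * N * n ≤ M := by
        rw [Nat.mul_succ] at hM
        omega
      have hLM : L + 3 * N ≤ M := by omega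
      have hbits :
          (accSyms ((readBlock x).bits, false)).length = (readBlock x).bits.length + 1 := by
        simp [accSyms]
      have hlx := length_readBlock_rest x
      obtain ⟨hw₁, hw₂, hw₃⟩ := length_passRow_le (M := L) accs (readBlock x).rest y
        ((readBlock x).bits, false) (ok && (readBlock x).isNumber) haL (by omega) hyL
      have hl := length_passRow_accs accs (readBlock x).rest y ((readBlock x).bits, false)
        (ok && (readBlock x).isNumber)
      have hx' := length_passRow_x accs (readBlock x).rest y ((readBlock x).bits, false)
        (ok && (readBlock x).isNumber)
      have hrest := length_readBlock_rest_lt hne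
      have h₁ := runs_rowProg (i := i) (o := o) (M := M) (N := N) x.head? accs x y ok
        (fun a h => by have := haL a h; omega) (by omega) (by omega) (by omega) _ rfl
      generalize passRow accs (readBlock x).rest y ((readBlock x).bits, false)
        (ok && (readBlock x).isNumber) = r at hw₁ hw₂ hw₃ hl hx' h₁ ⊢
      have htail : r.x.tail.length ≤ n := by
        rw [List.length_tail]
        omega
      obtain ⟨h₂, h₃⟩ := ih (L := L + 3 * N) r.x.tail r.y (r.accs ++ [r.d])
        (r.ok && decide (r.x.head? = some (Sum.inr false))) htail
        (by simp only [List.length_append, List.length_singleton]; omega)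
        (by rw [List.length_tail]; omega) (by omega)
        (fun a h => by
          rcases List.mem_append.1 h with h | h
          · have := hw₁ a h
            omega
          · rw [List.mem_singleton.1 h]
            omega) hM'
      refine ⟨Runs.loop_step_eq ?_ ?_ h₁ h₂ ?_, h₃⟩
      · simp [runBlock, Act.run, mem]
      · cases x with
        | nil => exact absurd rfl hne
        | cons s x => rfl
      · rw [Nat.add_one_mul n]
        omega

end CoverVerifier

/-! ### Final test, input, and the complete machine -/

namespace CoverVerifier

open StackProgram Turing

variable {i : List InLetter} {o : List Bool}

/-- One step of the test whether all accumulators are positive. The first component tells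
whether the test has not failed yet, the second one whether a bit one has been seen in the current
accumulator. -/
def scanStep (q : Bool × Bool) : Sym → Bool × Bool
  | Sum.inl b => (q.1, q.2 || b)
  | Sum.inr s => (q.1 && (!s && q.2), false)

theorem foldl_scanStep_accSyms (a : Acc) (ok seen : Bool) :
    (accSyms a).foldl scanStep (ok, seen) = (ok && (!a.2 && (seen || a.1.any id)), false) := by
  obtain ⟨l, s⟩ := a
  have h : accSyms (l, s) = l.map Sum.inl ++ [Sum.inr s] := rfl
  rw [h]
  clear h
  induction l generalizing seen with
  | nil => simp [scanStep]
  | cons b l ih =>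
    rw [List.map_cons, List.cons_append, List.foldl_cons, scanStep, ih]
    simp [Bool.or_assoc]

theorem foldl_scanStep (accs : List Acc) (ok : Bool) :
    (accs.flatMap accSyms).foldl scanStep (ok, false) = (ok && accs.all accPos, false) := by
  induction accs generalizing ok with
  | nil => simp
  | cons a l ih =>
    rw [List.flatMap_cons, List.foldl_append, foldl_scanStep_accSyms, ih]
    simp [accPos, Bool.and_assoc]

/-- Testing whether all accumulators are positive. -/
def scanLoop : VProg :=
  Prog.loop [popCur Work.A] (fun r => r.cur.isSome)
    (Prog.block [Act.load fun r =>
      { r with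
        ok := (scanStep (r.ok, r.seen) (r.cur.getD (Sum.inr false))).1
        seen := (scanStep (r.ok, r.seen) (r.cur.getD (Sum.inr false))).2 }])

theorem runs_scanLoop (ok seen : Bool) (c : Option Sym) (x y a b d e p t u v : List Sym) :
    Runs scanLoop
      ({ ok := ok, seen := seen, cur := c }, contents i o (mem x y a b d e p t u v))
      ({ ok := (a.foldl scanStep (ok, seen)).1, seen := (a.foldl scanStep (ok, seen)).2 },
        contents i o (mem x y [] b d e p t u v)) (2 * a.length + 1) := by
  induction a generalizing ok seen c with
  | nil =>
    refine Runs.loop_exit_eq ?_ rfl le_rfl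
    simp [runBlock, Act.run, popCur, update_mem, mem]
  | cons s a ih =>
    refine Runs.loop_step_eq
      (s₀ := ({ ok := ok, seen := seen, cur := some s }, contents i o (mem x y a b d e p t u v)))
      ?_ rfl (Runs.block_eq rfl le_rfl) (t' := 2 * a.length + 1) ?_ (by simp; omega)
    · simp [runBlock, Act.run, popCur, update_mem, mem]
    · exact ih (scanStep (ok, seen) s).1 (scanStep (ok, seen) s).2 (some s)

/-- Emptying the stack `Y`. -/
def drainY : VProg :=
  Prog.loop [popCur Work.Y] (fun r => r.cur.isSome) (Prog.block [])

theorem runs_drainY (r : Reg) (x y a b d e p t u v : List Sym) :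
    Runs drainY (r, contents i o (mem x y a b d e p t u v))
      ({ r with cur := none }, contents i o (mem x [] a b d e p t u v)) (2 * y.length + 1) := by
  induction y generalizing r with
  | nil =>
    refine Runs.loop_exit_eq ?_ rfl le_rfl
    simp [runBlock, Act.run, popCur, update_mem, mem]
  | cons s y ih =>
    refine Runs.loop_step_eq
      (s₀ := ({ r with cur := some s }, contents i o (mem x y a b d e p t u v)))
      ?_ rfl (Runs.block_eq rfl le_rfl) (t' := 2 * y.length + 1) ?_ (by simp; omega)
    · simp [runBlock, Act.run, popCur, update_mem, mem]
    · exact ih { r with cur := some s }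

/-- The symbol given by a letter of the first word. -/
def leftSym : Option InLetter → Option Sym
  | some (some (Sum.inl s)) => some (toSym s)
  | _ => none

/-- The symbol given by a letter of the second word. -/
def rightSym : Option InLetter → Option Sym
  | some (some (Sum.inr s)) => some (toSym s)
  | _ => none

/-- Moving the first word and the separator from the input onto `T`. -/
def readLeft : VProg :=
  Prog.loop [Act.pop Stack.inp fun r s => { r with cur := leftSym s }] (fun r => r.cur.isSome)
    (Prog.block [pushCur Work.T])

/-- Moving the second word from the input onto `B`. -/
def readRight : VProg :=
  Prog.loop [Act.pop Stack.inp fun r s => { r with cur := rightSym s }] (fun r => r.cur.isSome)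
    (Prog.block [pushCur Work.B])

/-- The pop that ends the loop also consumes the separator between the two words. -/
theorem runs_readLeft (r : Reg) (l : List (Option Bool)) (i : List InLetter)
    (x y a b d e p t u v : List Sym) :
    Runs readLeft
      (r, contents (l.map (fun s => some (Sum.inl s)) ++ none :: i) o (mem x y a b d e p t u v))
      ({ r with cur := none },
        contents i o (mem x y a b d e p ((l.map toSym).reverse ++ t) u v))
      (2 * l.length + 1) := by
  induction l generalizing r t with
  | nil =>
    refine Runs.loop_exit_eq ?_ rfl le_rfl
    simp [runBlock, Act.run, leftSym]
  | cons s l ih =>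
    refine Runs.loop_step_eq (s₀ := ({ r with cur := some (toSym s) },
      contents (l.map (fun s => some (Sum.inl s)) ++ none :: i) o (mem x y a b d e p t u v)))
      ?_ rfl (Runs.block_eq rfl le_rfl) (t' := 2 * l.length + 1) ?_ (by simp; omega)
    · simp [runBlock, Act.run, leftSym]
    · have h := ih { r with cur := some (toSym s) } (toSym s :: t)
      simpa [runBlock, Act.run, pushCur, update_mem, mem, readLeft] using h

theorem runs_readRight (r : Reg) (l : List (Option Bool)) (x y a b d e p t u v : List Sym) :
    Runs readRight
      (r, contents (l.map (fun s => some (Sum.inr s))) o (mem x y a b d e p t u v))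
      ({ r with cur := none },
        contents [] o (mem x y a ((l.map toSym).reverse ++ b) d e p t u v))
      (2 * l.length + 1) := by
  induction l generalizing r b with
  | nil =>
    refine Runs.loop_exit_eq ?_ rfl le_rfl
    simp [runBlock, Act.run, rightSym]
  | cons s l ih =>
    refine Runs.loop_step_eq (s₀ := ({ r with cur := some (toSym s) },
      contents (l.map (fun s => some (Sum.inr s))) o (mem x y a b d e p t u v)))
      ?_ rfl (Runs.block_eq rfl le_rfl) (t' := 2 * l.length + 1) ?_ (by simp; omega)
    · simp [runBlock, Act.run, rightSym]
    · have h := ih { r with cur := some (toSym s) } (toSym s :: b)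
      simpa [runBlock, Act.run, pushCur, update_mem, mem, readRight] using h

/-- The program of the verifier. -/
def verifierProg : VProg :=
  Prog.seq readLeft (Prog.seq readRight (Prog.seq (move Work.T Work.X) (Prog.seq
    (move Work.B Work.Y) (Prog.seq rowsLoop (Prog.seq
      (Prog.block [Act.peek (Stack.work Work.Y) fun r s => { r with ok := r.ok && s.isNone }])
      (Prog.seq drainY (Prog.seq scanLoop
        (Prog.block [Act.push Stack.out fun r => r.ok, Act.load fun _ => { ok := true }]))))))))

/-- A bound for the lengths of accumulators on inputs of length `n`. -/
def widthBound (n : ℕ) : ℕ := n + 3 * n * n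

/-- A bound for the running time on inputs of length `n`. -/
def timeBound (n : ℕ) : ℕ :=
  n * (n * (14 * widthBound n + 2 * (n * widthBound n) + 21) + 2 * (n * widthBound n) +
    8 * widthBound n + 11) + 2 * (n * widthBound n) + 2 * widthBound n + 8 * n + 9

/-- The halting convention of the machine asks for the initial register and for empty stacks apart
from the output, so `Y` is drained and the register reset. -/
theorem runs_verifierProg (x y : List (Option Bool)) :
    Runs verifierProg
      ({ ok := true }, contents (encodePair (x, y)) [] (mem [] [] [] [] [] [] [] [] [] []))
      ({ ok := true }, contents [] [verify x y] (mem [] [] [] [] [] [] [] [] [] []))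
      (timeBound (encodePair (x, y)).length) := by
  have hn : (encodePair (x, y)).length = x.length + y.length + 1 := by
    simp [encodePair]
    omega
  rw [hn]
  set n := x.length + y.length + 1 with hn_def
  have h₁ := runs_readLeft (o := []) { ok := true } x (y.map fun s => some (Sum.inr s))
    [] [] [] [] [] [] [] [] [] []
  have h₂ := runs_readRight (o := []) { ok := true } y [] [] [] [] [] [] []
    (x.map toSym).reverse [] []
  rw [List.append_nil] at h₁ h₂
  have h₃ := runs_move (i := []) (o := []) (k := Work.T) (k' := Work.X) (by decide) { ok := true }
    (mem [] [] [] (y.map toSym).reverse [] [] [] (x.map toSym).reverse [] [])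
  simp only [update_mem, mem, List.append_nil, List.reverse_reverse] at h₃
  have h₄ := runs_move (i := []) (o := []) (k := Work.B) (k' := Work.Y) (by decide) { ok := true }
    (mem (x.map toSym) [] [] (y.map toSym).reverse [] [] [] [] [] [])
  simp only [update_mem, mem, List.append_nil, List.reverse_reverse] at h₄
  -- The length `n` includes the separator of the pair, which leaves room for `x.length + 1 ≤ n`.
  obtain ⟨h₅, hy, hl, ha⟩ := runs_rowsLoop (i := []) (o := []) (L := n) (M := widthBound n) (N := n)
    x.length (x.map toSym) (y.map toSym) [] true (by simp) (by simp; omega) (by simp; omega)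
    (by simp; omega) (by simp)
    (Nat.add_le_add_left (Nat.mul_le_mul_left _ (by omega)) n)
  have hv : verify x y =
      ((passRows x.length (x.map toSym) (y.map toSym) [] true).ok &&
        (passRows x.length (x.map toSym) (y.map toSym) [] true).y.isEmpty &&
        (passRows x.length (x.map toSym) (y.map toSym) [] true).accs.all accPos) := rfl
  rw [hv]
  generalize passRows x.length (x.map toSym) (y.map toSym) [] true = r at h₅ hy hl ha ⊢
  have h₆ := runs_drainY (i := []) (o := []) { ok := r.ok && r.y.isEmpty } [] r.y
    (r.accs.flatMap accSyms) [] [] [] [] [] [] []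
  have h₇ := runs_scanLoop (i := []) (o := []) (r.ok && r.y.isEmpty) false none [] []
    (r.accs.flatMap accSyms) [] [] [] [] [] [] []
  rw [foldl_scanStep] at h₇
  have hA : (r.accs.flatMap accSyms).length ≤ n * widthBound n :=
    (length_flatMap_accSyms_le ha).trans (Nat.mul_le_mul_right _ hl)
  refine Runs.seq h₁ (Runs.seq h₂ (Runs.seq h₃ (Runs.seq h₄ (Runs.seq h₅ (Runs.seq
    (Runs.block_eq ?_ le_rfl) (Runs.seq h₆ (Runs.seq h₇ (Runs.block_eq ?_ le_rfl)
      le_rfl) le_rfl) le_rfl) le_rfl) le_rfl) le_rfl) le_rfl) ?_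
  · have hh (l : List Sym) : l.head?.isNone = l.isEmpty := by cases l <;> rfl
    simp [runBlock, Act.run, mem, hh]
  · simp [runBlock, Act.run]
  · have := Nat.mul_le_mul_right (n * (14 * widthBound n + 2 * (n * widthBound n) + 21) +
      2 * (n * widthBound n) + 8 * widthBound n + 11) (show x.length ≤ n by omega)
    simp only [List.length_reverse, List.length_map, timeBound]
    omega

/-- The machine that executes the program of the verifier. -/
noncomputable def verifierMachine : FinTM2 where
  K := Stack
  k₀ := Stack.inp
  k₁ := Stack.out
  Γ := Alphabet
  Λ := verifierProg.Pos
  main := verifierProg.entry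
  ΛFin := @Fintype.ofFinite _ verifierProg.finite_pos
  σ := Reg
  initialState := { ok := true }
  σFin := Fintype.ofFinite Reg
  Γk₀Fin := inferInstanceAs (Fintype InLetter)
  m := verifierProg.code id TM2.Stmt.halt

theorem initList_verifierMachine (l : List InLetter) :
    initList verifierMachine l = ⟨some verifierProg.entry, { ok := true },
      contents l [] (mem [] [] [] [] [] [] [] [] [] [])⟩ := by
  refine congrArg (TM2.Cfg.mk _ _) (funext fun k => ?_)
  rcases k with _ | _ | k
  · rfl
  · rfl
  · cases k <;> rfl

theorem haltList_verifierMachine (l : List Bool) :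
    haltList verifierMachine l = ⟨none, { ok := true },
      contents [] l (mem [] [] [] [] [] [] [] [] [] [])⟩ := by
  refine congrArg (TM2.Cfg.mk _ _) (funext fun k => ?_)
  rcases k with _ | _ | k
  · rfl
  · rfl
  · cases k <;> rfl

/-- The bound for the lengths of accumulators as a polynomial. -/
noncomputable def widthPoly : Polynomial ℕ := Polynomial.X + 3 * Polynomial.X * Polynomial.X

/-- The bound for the running time as a polynomial. -/
noncomputable def timePoly : Polynomial ℕ :=
  Polynomial.X * (Polynomial.X * (14 * widthPoly + 2 * (Polynomial.X * widthPoly) + 21) +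
    2 * (Polynomial.X * widthPoly) + 8 * widthPoly + 11) + 2 * (Polynomial.X * widthPoly) +
    2 * widthPoly + 8 * Polynomial.X + 9

theorem eval_timePoly (n : ℕ) : timePoly.eval n = timeBound n := by
  simp [timePoly, widthPoly, timeBound, widthBound]

theorem exists_steps_verifierMachine (x y : List (Option Bool)) :
    ∃ k ≤ timeBound (encodePair (x, y)).length,
      (flip bind verifierMachine.step)^[k] (some (initList verifierMachine (encodePair (x, y)))) =
        some (haltList verifierMachine [verify x y]) := by
  obtain ⟨k, hk, h⟩ := (runs_verifierProg x y).stepIter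
    (M := verifierProg.code id TM2.Stmt.halt) id TM2.Stmt.halt fun _ => rfl
  refine ⟨k, hk, ?_⟩
  rw [initList_verifierMachine]
  exact h.trans (congrArg some (haltList_verifierMachine [verify x y]).symm)

theorem polyTimeDecidable_moveCountCertificate : PolyTimeDecidable MoveCountCertificate := by
  refine ⟨fun w => verify w.1 w.2, fun x y => verify_iff x y, ⟨?_⟩⟩
  exact
    { tm := verifierMachine
      inputAlphabet := Equiv.refl _
      outputAlphabet := Equiv.refl _
      time := timePoly
      outputsFun := fun w =>
        have h := exists_steps_verifierMachine w.1 w.2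
        { steps := h.choose
          evals_in_steps := by
            -- The alphabets are identified by `Equiv.refl`, so the two runs differ only by a map
            -- along the identity.
            refine Eq.trans ?_ h.choose_spec.2
            congr 3
            exact List.map_id _
          steps_le_m := by
            rw [eval_timePoly]
            exact h.choose_spec.1 } }

end CoverVerifier

theorem isPolyVerifier_moveCountCertificate :
    IsPolyVerifier MoveCountCertificate coverSolvability := by
  refine ⟨CoverVerifier.polyTimeDecidable_moveCountCertificate,
    fun _ _ h => mem_coverSolvability_of_certificate h,
    Polynomial.X * (Polynomial.X * (2 * (Polynomial.X + 1))), fun x hx => ?_⟩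
  simpa using exists_short_certificate hx

theorem corollary8 :
    coverSolvability ∈ NP (Option Bool) ∧
      IsPolyVerifier MoveCountCertificate coverSolvability := by
  exact ⟨⟨Option Bool, inferInstance, MoveCountCertificate, isPolyVerifier_moveCountCertificate⟩,
    isPolyVerifier_moveCountCertificate⟩
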